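/- Let $p$ be an odd prime, let $K$ be a quadratic number field, and let $N/K$ be a cyclic extension of degree $p$ that is unramified at all finite primes. Let $\varrho_p=\dim_{\mathbb F_p}\mathrm{Cl}(K)/\mathrm{Cl}(K)^p$ be the $p$-class rank of $K$. Then the conductor of $N/K$ is $f=1$, and the differential principal factorization (DPF) type of $N$ is given by (1)-(3) below. For a number field $F$ let $U_F$, $I_F$, $P_F$, $\mathrm{Cl}(F)$ be the groups of units, of nonzero fractional ideals, of nonzero principal fractional ideals and of ideal classes; for an extension $F/E$ of degree $p$ regard $I_E$ as a subgroup of $I_F$ and put $I_{F/E}=\{\mathfrak a\in I_F:\mathfrak a^p\in I_E\}$, $P_{F/E}=I_{F/E}\cap P_F$. Let $L$ be any subfield of $N$ of degree $p$ over $\mathbb Q$ (the choice does not matter). Consider the dimensions over $\mathbb F_p$ $$U=\dim U_K/N_{N/K}(U_N),\quad A=\dim P_{L/\mathbb Q}/P_{\mathbb Q},\quad C=\dim\ker\bigl(\mathrm{Cl}(K)\to\mathrm{Cl}(N)\bigr),$$ $$R=\dim\Bigl((P_{N/K}I_K/I_K)\cap\ker\bigl(N_{N/L}:I_{N/K}/I_K\to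 I_{L/\mathbb Q}/I_{\mathbb Q}\bigr)\Bigr).$$ The types are defined for $N$ that are Galois over $\mathbb Q$ with dihedral group of order $2p$ (having a type includes this property). A totally real $N$ has type $\alpha_1$ if $(U,A,R,C)=(1,0,0,2)$ and type $\delta_1$ if $(U,A,R,C)=(0,0,0,1)$. A totally complex $N$ has type $\alpha_1$ if $(U,A,R,C)=(0,0,0,1)$. (1) If $N$ is totally real and $\varrho_p=1$, then $N$ is of type $\delta_1$. (2) If $N$ is totally real and $\varrho_p\ge 2$, then $N$ is of type $\alpha_1$ or of type $\delta_1$. (3) If $N$ is totally complex, then $N$ is of type $\alpha_1$, whatever $\varrho_p$ is. -/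

import Mathlib

open scoped NumberField nonZeroDivisors

noncomputable section

namespace DPF

/-- The commutative group `V`, written multiplicatively, is an `𝔽_p`-vector space of dimension `n`:
it has exponent dividing `p` and exactly `p ^ n` elements. -/
def IsFpSpaceOfDim (p : ℕ) (V : Type*) [CommGroup V] (n : ℕ) : Prop :=
  (∀ v : V, v ^ p = 1) ∧ Nat.card V = p ^ n

/-- `ϱ` is the `p`-class rank of `K`, the dimension of `Cl(K) / Cl(K) ^ p` over `𝔽_p`. -/
def HasPClassRank (p : ℕ) (K : Type*) [Field K] [NumberField K] (ϱ : ℕ) : Prop :=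
  IsFpSpaceOfDim p (ClassGroup (𝓞 K) ⧸ (powMonoidHom p : ClassGroup (𝓞 K) →* _).range) ϱ

/-! ### The conductor of an abelian extension -/

section Conductor

variable (K N : Type*) [Field K] [NumberField K] [Field N] [NumberField N] [Algebra K N]

/-- An integer `x` of `K` is a norm residue at the prime `v` for `N/K` if it is congruent to a norm
of an integer of `N` modulo every power of `v`. For `x` prime to `v` and `N/K` Galois, this says
that `x` is a norm from the completion of `N` at a prime above `v` (norm groups are closed). -/
def IsNormResidue (v : IsDedekindDomain.HeightOneSpectrum (𝓞 K)) (x : 𝓞 K) : Prop :=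
  ∀ m : ℕ, ∃ y : 𝓞 N, RingOfIntegers.norm K y - x ∈ v.asIdeal ^ m

/-- The conductor exponent of the abelian extension `N/K` at `v`: the least `n ≥ 0` such that all
`v`-adic units congruent to `1` modulo `v ^ n` are local norms. -/
def conductorExponent (v : IsDedekindDomain.HeightOneSpectrum (𝓞 K)) : ℕ :=
  sInf {n : ℕ | ∀ x : 𝓞 K, x ∉ v.asIdeal → x - 1 ∈ v.asIdeal ^ n → IsNormResidue K N v x}

/-- The (finite part of the) class field theoretic conductor of the abelian extension `N/K`. -/
def conductorIdeal : Ideal (𝓞 K) :=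
  ∏ᶠ v : IsDedekindDomain.HeightOneSpectrum (𝓞 K), v.asIdeal ^ conductorExponent K N v

/-- The abelian extension `N/K` has the natural number `f` as its conductor. -/
def HasConductor (f : ℕ) : Prop :=
  conductorIdeal K N = Ideal.span {(f : 𝓞 K)}

end Conductor

/-! ### Groups of fractional ideals -/

/-- The group `I_F` of nonzero fractional ideals of a number field `F`. -/
abbrev Ideals (F : Type*) [Field F] [NumberField F] : Type _ := (FractionalIdeal (𝓞 F)⁰ F)ˣ

/-- The group `P_F` of nonzero principal fractional ideals of `F`. -/
abbrev principalIdeals (F : Type*) [Field F] [NumberField F] : Subgroup (Ideals F) :=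
  (toPrincipalIdeal (𝓞 F) F).range

section Ideals

variable (E F : Type*) [Field E] [NumberField E] [Field F] [NumberField F] [Algebra E F]

/-- The extension of ideals `I_E → I_F`, `𝔞 ↦ 𝔞 𝓞_F`. -/
def extendIdeals : Ideals E →* Ideals F :=
  Units.map (FractionalIdeal.extendedHom (A := 𝓞 E) (K := E) F (𝓞 F)).toMonoidHom

/-- The relative norm of fractional ideals on underlying ideals: if `𝔞 = I / d` with an integral
ideal `I` and `d ∈ 𝓞_F`, then the norm of `𝔞` is `N(I) / N(d)`. -/
def relNormAux (𝔞 : FractionalIdeal (𝓞 F)⁰ F) : FractionalIdeal (𝓞 E)⁰ E :=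
  (Ideal.relNorm (𝓞 E) 𝔞.num : FractionalIdeal (𝓞 E)⁰ E) /
    (Ideal.relNorm (𝓞 E) (Ideal.span {(𝔞.den : 𝓞 F)}) : FractionalIdeal (𝓞 E)⁰ E)

/-- The relative norm can be computed from any presentation as a quotient of integral ideals. -/
theorem relNormAux_eq (𝔞 : FractionalIdeal (𝓞 F)⁰ F) (I J : Ideal (𝓞 F)) (hJ : J ≠ ⊥)
    (h : 𝔞 * (J : FractionalIdeal (𝓞 F)⁰ F) = I) :
    relNormAux E F 𝔞 = (Ideal.relNorm (𝓞 E) I : FractionalIdeal (𝓞 E)⁰ E) /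
      (Ideal.relNorm (𝓞 E) J : FractionalIdeal (𝓞 E)⁰ E) := by
  have hd : Ideal.span {(𝔞.den : 𝓞 F)} ≠ ⊥ := by
    rw [Ne, Ideal.span_singleton_eq_bot]
    exact nonZeroDivisors.coe_ne_zero _
  have hn : 𝔞 * (Ideal.span {(𝔞.den : 𝓞 F)} : FractionalIdeal (𝓞 F)⁰ F) = 𝔞.num := by
    rw [← FractionalIdeal.den_mul_self_eq_num', FractionalIdeal.coeIdeal_span_singleton, mul_comm]
  have key : 𝔞.num * J = I * Ideal.span {(𝔞.den : 𝓞 F)} := by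
    apply FractionalIdeal.coeIdeal_injective (K := F)
    change ((𝔞.num * J : Ideal (𝓞 F)) : FractionalIdeal (𝓞 F)⁰ F) =
      ((I * Ideal.span {(𝔞.den : 𝓞 F)} : Ideal (𝓞 F)) : FractionalIdeal (𝓞 F)⁰ F)
    rw [FractionalIdeal.coeIdeal_mul, FractionalIdeal.coeIdeal_mul, ← hn, ← h]
    ring
  have hne : ∀ A : Ideal (𝓞 F), A ≠ ⊥ →
      (Ideal.relNorm (𝓞 E) A : FractionalIdeal (𝓞 E)⁰ E) ≠ 0 := fun A hA => by
    rw [Ne, FractionalIdeal.coeIdeal_eq_zero]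
    exact fun h0 => hA (Ideal.relNorm_eq_bot_iff.mp h0)
  rw [relNormAux, div_eq_div_iff (hne _ hd) (hne _ hJ), ← FractionalIdeal.coeIdeal_mul,
    ← FractionalIdeal.coeIdeal_mul, ← map_mul, ← map_mul, key]

/-- The relative norm of ideals `N_{F/E} : I_F → I_E`. -/
def relNorm : Ideals F →* Ideals E where
  toFun 𝔞 := Units.mk0 (relNormAux E F 𝔞) (by
    have hd : Ideal.span {((𝔞 : FractionalIdeal (𝓞 F)⁰ F).den : 𝓞 F)} ≠ ⊥ := by
      rw [Ne, Ideal.span_singleton_eq_bot]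
      exact nonZeroDivisors.coe_ne_zero _
    refine div_ne_zero ?_ ?_ <;> rw [Ne, FractionalIdeal.coeIdeal_eq_zero]
    · exact fun h0 => 𝔞.ne_zero
        (FractionalIdeal.num_eq_zero_iff.mp (Ideal.relNorm_eq_bot_iff.mp h0))
    · exact fun h0 => hd (Ideal.relNorm_eq_bot_iff.mp h0))
  map_one' := by
    ext1
    simpa using relNormAux_eq E F 1 1 1 one_ne_zero (by simp)
  map_mul' 𝔞 𝔟 := by
    ext1
    have hd : ∀ 𝔠 : FractionalIdeal (𝓞 F)⁰ F, Ideal.span {(𝔠.den : 𝓞 F)} ≠ ⊥ := fun 𝔠 => by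
      rw [Ne, Ideal.span_singleton_eq_bot]
      exact nonZeroDivisors.coe_ne_zero _
    have hn : ∀ 𝔠 : FractionalIdeal (𝓞 F)⁰ F,
        𝔠 * (Ideal.span {(𝔠.den : 𝓞 F)} : FractionalIdeal (𝓞 F)⁰ F) = 𝔠.num := fun 𝔠 => by
      rw [← FractionalIdeal.den_mul_self_eq_num', FractionalIdeal.coeIdeal_span_singleton, mul_comm]
    simp only [Units.val_mk0, Units.val_mul]
    rw [relNormAux_eq E F (𝔞 * 𝔟 : FractionalIdeal (𝓞 F)⁰ F)
      ((𝔞 : FractionalIdeal (𝓞 F)⁰ F).num * (𝔟 : FractionalIdeal (𝓞 F)⁰ F).num) _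
      (mul_ne_zero (hd 𝔞) (hd 𝔟)) (by
        rw [FractionalIdeal.coeIdeal_mul, FractionalIdeal.coeIdeal_mul, ← hn 𝔞, ← hn 𝔟]; ring)]
    simp only [relNormAux, map_mul, FractionalIdeal.coeIdeal_mul]
    rw [mul_div_mul_comm]
    rfl

/-- The group `I_{F/E}` of ambiguous ideals of an extension `F/E` of degree `p`: those `𝔞 ∈ I_F`
with `𝔞 ^ p ∈ I_E`. -/
def ambiguousIdeals (p : ℕ) : Subgroup (Ideals F) :=
  (extendIdeals E F).range.comap (powMonoidHom p)

/-- The group `P_{F/E} = I_{F/E} ∩ P_F` of ambiguous principal ideals of `F/E`. -/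
def ambiguousPrincipalIdeals (p : ℕ) : Subgroup (Ideals F) :=
  ambiguousIdeals E F p ⊓ principalIdeals F

end Ideals

/-! ### Galois cohomology and differential principal factorizations -/

section Invariants

variable (p : ℕ) (K N : Type*) [Field K] [NumberField K] [Field N] [NumberField N] [Algebra K N]

/-- The group `U_K / N_{N/K}(U_N)`, which is `Ĥ⁰(G, U_N)` for `N/K` Galois with group `G`. -/
abbrev UnitNormIndex : Type _ :=
  (𝓞 K)ˣ ⧸ (Units.map (RingOfIntegers.norm K : 𝓞 N →* 𝓞 K)).range

/-- The space `P_{L/ℚ} / P_ℚ` of absolute differential principal factorizations. -/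
abbrev AbsoluteDPF (L : IntermediateField ℚ N) : Type _ :=
  ambiguousPrincipalIdeals ℚ L p ⧸
    ((principalIdeals ℚ).map (extendIdeals ℚ L)).subgroupOf (ambiguousPrincipalIdeals ℚ L p)

/-- The ambiguous principal ideals of `N/K` whose class in `I_{N/K} / I_K` is killed by the norm
`N_{N/L} : I_{N/K} / I_K → I_{L/ℚ} / I_ℚ`. -/
def normKernel (L : IntermediateField ℚ N) : Subgroup (Ideals N) :=
  ambiguousPrincipalIdeals K N p ⊓ (extendIdeals ℚ L).range.comap (relNorm L N)

/-- The space of relative differential principal factorizations: the intersection of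
`P_{N/K} I_K / I_K` with the kernel of `N_{N/L} : I_{N/K} / I_K → I_{L/ℚ} / I_ℚ`. -/
abbrev RelativeDPF (L : IntermediateField ℚ N) : Type _ :=
  normKernel p K N L ⧸ (extendIdeals K N).range.subgroupOf (normKernel p K N L)

/-- The capitulation kernel: the ideal classes of `K` that become principal in `N`. (It is killed
by `[N : K]`, so for `[N : K] = p` it is contained in the `p`-class group of `K`.) -/
abbrev CapitulationKernel : Type _ := (ClassGroup.extendedHom (𝓞 K) (𝓞 N)).ker

/-- The field `N`, with quadratic subfield `K`, is absolutely dihedral of degree `2p`; the group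
`U_K / N_{N/K}(U_N)` has `𝔽_p`-dimension `U`; and `A`, `R`, `C` are the dimensions of the spaces of
absolute differential principal factorizations, relative differential principal factorizations and
capitulation. The first two are formed with any of the (conjugate) subfields `L` of degree `p`. -/
structure HasDPFInvariants (U A R C : ℕ) : Prop where
  isGalois : IsGalois ℚ N
  dihedral : Nonempty (Gal(N/ℚ) ≃* DihedralGroup p)
  unitNormIndex : IsFpSpaceOfDim p (UnitNormIndex K N) U
  absolute : ∀ L : IntermediateField ℚ N, Module.finrank ℚ L = p →
    IsFpSpaceOfDim p (AbsoluteDPF p N L) A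
  relative : ∀ L : IntermediateField ℚ N, Module.finrank ℚ L = p →
    IsFpSpaceOfDim p (RelativeDPF p K N L) R
  capitulation : IsFpSpaceOfDim p (CapitulationKernel K N) C

/-- The differential principal factorization types of totally real dihedral fields. -/
inductive RealType
  | α₁ | α₂ | α₃ | β₁ | β₂ | γ | δ₁ | δ₂ | ε

/-- The differential principal factorization types of totally complex dihedral fields. -/
inductive ComplexType
  | α₁ | α₂ | β

/-- The totally real dihedral field `N` has the given type; the arguments of `HasDPFInvariants`
are `U`, `A`, `R`, `C`. -/
def IsOfRealType : RealType → Prop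
  | .α₁ => HasDPFInvariants p K N 1 0 0 2
  | .α₂ => HasDPFInvariants p K N 1 0 1 1
  | .α₃ => HasDPFInvariants p K N 1 0 2 0
  | .β₁ => HasDPFInvariants p K N 1 1 0 1
  | .β₂ => HasDPFInvariants p K N 1 1 1 0
  | .γ => HasDPFInvariants p K N 1 2 0 0
  | .δ₁ => HasDPFInvariants p K N 0 0 0 1
  | .δ₂ => HasDPFInvariants p K N 0 0 1 0
  | .ε => HasDPFInvariants p K N 0 1 0 0

/-- The totally complex dihedral field `N` has the given type; the arguments of `HasDPFInvariants`
are `U`, `A`, `R`, `C`. -/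
def IsOfComplexType : ComplexType → Prop
  | .α₁ => HasDPFInvariants p K N 0 0 0 1
  | .α₂ => HasDPFInvariants p K N 0 0 1 0
  | .β => HasDPFInvariants p K N 0 1 0 0

end Invariants

end DPF

end

/-!
The extension `N/K` is unramified everywhere, also at the infinite places because its degree is odd.
No class field theory is needed; everything follows from four observations.

*The Galois group.* Let `M` be the normal closure of `N` over `ℚ`. Commutators in `Gal(M/K)` fix all
conjugates of `N`, so `Gal(M/K)` is abelian. An element of an inertia group of `M/ℚ` that lies in
`Gal(M/K)` restricts to an inertia element of `N/K` and of all its conjugates, hence is trivial. So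
the inertia elements are involutions outside the abelian subgroup `Gal(M/K)` of index two, and by
Minkowski's theorem they generate `Gal(M/ℚ)` (`iSup_inertia_eq_top`). Therefore an involution
inverts `Gal(M/K)` (`exists_involution_inverting`), every subgroup of `Gal(M/K)` is normal, and
`M = N` has a dihedral group over `ℚ`.

*Ambiguous ideals.* If all ramification indices divide `m`, the `m`-th power of a Galois invariant
ideal is extended from the base (`exists_map_eq_pow_of_forall_smul_eq`). A principal ideal whose
`p`-th power is so extended is invariant, because `p`-th roots of units are units. With `m = 1` for
`N/K` this gives `R = 0`; with `m = 2` for `N/ℚ`, which is prime to `p`, it gives `A = 0`.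

*Capitulation.* If an ideal of `K` becomes principal in `N` with generator `α`, then all `g α / α`
are units, and Hilbert's Theorem 90 identifies the capitulation kernel with the units of norm one
modulo the `g u / u`, where `u` is a unit. The Herbrand quotient of the units, computed from
Dirichlet's unit theorem by comparing `(s - 1) ^ (p - 1)` with `p` (`relIndex_range_sub_one_eq`),
yields `C = U + 1` (`card_capitulationKernel`). Finally `U_K / N(U_N)` is a quotient of
`U_K / U_K ^ p`. For real `K` the latter has order `p`, and `C ≤ ϱ` forces `U = 0` if `ϱ = 1`. For
imaginary `K` it is trivial unless `K = ℚ(ζ₃)`, whose class number one contradicts `C ≥ 1`.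

*The conductor.* At an unramified prime, norm and trace are onto modulo the prime, and a solution
`y` of `N(y) ≡ x` modulo a power of the prime is improved by a factor `1 + π z`. So all units are
norm residues and all conductor exponents vanish (`hasConductor_iff`).
-/

namespace DPF

/-! ### Galois invariant ideals -/

section InvariantIdeals

open Pointwise Ideal

variable {A B : Type*} [CommRing A] [IsDedekindDomain A] [CommRing B] [IsDedekindDomain B]
  [Algebra A B] [Algebra.IsIntegral A B] [Module.IsTorsionFree A B]
  (G : Type*) [Group G] [Finite G] [MulSemiringAction G B] [IsGaloisGroup G A B]

/-- If all ramification indices of the Galois extension `B/A` divide `m`, then the `m`-th power of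
a Galois invariant ideal of `B` is extended from `A`. An invariant ideal is a product of the
invariant ideals `∏_{P ∣ 𝔭} P`, whose `e(𝔭)`-th power is `𝔭 B`. -/
theorem exists_map_eq_pow_of_forall_smul_eq {m : ℕ}
    (hm : ∀ P : Ideal B, P.IsPrime → P ≠ ⊥ → P.ramificationIdx A ∣ m) (J : Ideal B) (hJ : J ≠ ⊥)
    (hinv : ∀ g : G, g • J = J) : ∃ b : Ideal A, b.map (algebraMap A B) = J ^ m := by
  classical
  induction J using IsNoetherian.induction with | _ J ih =>
  by_cases htop : J = ⊤
  · exact ⟨⊤, by rw [htop, Ideal.map_top, ← Ideal.one_eq_top, one_pow]⟩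
  obtain ⟨P, hPmax, hJP⟩ := Ideal.exists_le_maximal J htop
  have hP0 : P ≠ ⊥ := ne_bot_of_le_ne_bot hJ hJP
  obtain ⟨𝔭, h𝔭⟩ : ∃ 𝔭, 𝔭 = P.under A := ⟨_, rfl⟩
  have h𝔭0 : 𝔭 ≠ ⊥ := h𝔭 ▸ P.under_ne_bot A hP0
  have h𝔭max : 𝔭.IsMaximal := h𝔭 ▸ hPmax.under A
  let P₀ : primesOver 𝔭 B := ⟨P, hPmax.isPrime, ⟨h𝔭⟩⟩
  have hPlies : P.LiesOver 𝔭 := P₀.2.2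
  have hfin : Fintype (primesOver 𝔭 B) := (IsDedekindDomain.primesOver_finite 𝔭 B).fintype
  -- the largest invariant ideal contained in `P`; it divides `J`, and `ih` handles the cofactor
  obtain ⟨Q, hQ⟩ : ∃ Q : Ideal B, Q = ∏ P' : primesOver 𝔭 B, (P' : Ideal B) := ⟨_, rfl⟩
  have hne : ∀ P' : primesOver 𝔭 B, (P' : Ideal B) ≠ ⊥ := fun P' =>
    have := P'.2.2
    Ideal.ne_bot_of_liesOver_of_ne_bot h𝔭0 P'.1
  have hQ0 : Q ≠ ⊥ := hQ ▸ Finset.prod_ne_zero_iff.mpr fun P' _ => hne P'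
  have hQG : ∀ g : G, g • Q = Q := fun g => by
    rw [hQ, Finset.smul_prod']
    exact Fintype.prod_equiv (MulAction.toPerm g) _ _ fun P' => (coe_smul_primesOver g P').symm
  obtain ⟨J', hJ'⟩ : Q ∣ J := by
    rw [hQ]
    refine Fintype.prod_dvd_of_isRelPrime (fun P₁ P₂ h => ?_) fun P' => ?_
    · have h1 := P₁.2.1
      have h2 := P₂.2.1
      have h3 := h1.isMaximal (hne P₁)
      have h4 := h2.isMaximal (hne P₂)
      exact (Ideal.isCoprime_of_isMaximal (fun h' => h (Subtype.ext h'))).isRelPrime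
    · have := P'.2.1
      have := P'.2.2
      obtain ⟨g, hg⟩ := exists_smul_eq_of_isGaloisGroup 𝔭 P P'.1 G
      rw [Ideal.dvd_iff_le, ← hg, ← hinv g]
      exact Ideal.pointwise_smul_le_pointwise_smul_iff.mpr hJP
  have hJ'0 : J' ≠ ⊥ := by rintro rfl; exact hJ (by rw [hJ']; exact mul_zero _)
  have hJ'inv : ∀ g : G, g • J' = J' := fun g => by
    have := hinv g
    rw [hJ', smul_mul', hQG] at this
    exact mul_left_cancel₀ hQ0 this
  have hlt : J < J' := by
    refine lt_of_le_of_ne (hJ' ▸ Ideal.mul_le_right) fun h => ?_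
    rw [← h] at hJ'
    have h1 : Q = 1 := mul_right_cancel₀ hJ (by rw [one_mul]; exact hJ'.symm)
    have h2 : Q ≤ P := by
      have h3 : (P₀ : Ideal B) ∣ Q := hQ ▸ Finset.dvd_prod_of_mem
        (fun P' : primesOver 𝔭 B => (P' : Ideal B)) (Finset.mem_univ P₀)
      exact Ideal.le_of_dvd h3
    rw [h1, Ideal.one_eq_top, top_le_iff] at h2
    exact hPmax.ne_top h2
  obtain ⟨b', hb'⟩ := ih J' hlt hJ'0 hJ'inv
  have hmap : 𝔭.map (algebraMap A B) = Q ^ P.ramificationIdx A := by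
    rw [Ideal.map_algebraMap_eq_finsetProd_pow h𝔭0, hQ, ← Finset.prod_pow, ← Finset.prod_set_coe]
    refine Finset.prod_congr (Finset.ext (by simp)) fun P' _ => ?_
    have := P'.2.1
    have := P'.2.2
    rw [ramificationIdx_eq_of_isGaloisGroup 𝔭 P'.1 P G]
  obtain ⟨k, hk⟩ := hm P hPmax.isPrime hP0
  exact ⟨𝔭 ^ k * b', by
    rw [Ideal.map_mul, Ideal.map_pow, hmap, hb', ← pow_mul, ← hk, hJ', mul_pow]⟩

end InvariantIdeals

/-! ### Herbrand quotients of finitely generated abelian groups -/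

section Herbrand

open Module Polynomial

/-- The index `[M : f M] / |ker f|` of an endomorphism is multiplicative under composition. -/
theorem index_range_comp {M : Type*} [AddCommGroup M] (f g : M →+ M) :
    (f.comp g).range.index * Nat.card f.ker * Nat.card g.ker =
      f.range.index * g.range.index * Nat.card (f.comp g).ker := by
  have h1 : (f.comp g).range.index = (g.range ⊔ f.ker).index * f.range.index := by
    rw [AddMonoidHom.range_comp, AddSubgroup.index_map]
  have h2 : (g.range ⊓ f.ker).relIndex f.ker * (g.range ⊔ f.ker).index = g.range.index := by
    rw [AddSubgroup.inf_relIndex_right, ← AddSubgroup.relIndex_sup_right, sup_comm f.ker,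
      AddSubgroup.relIndex_mul_index le_sup_left]
  have h3 : Nat.card (g.range ⊓ f.ker : AddSubgroup M) * (g.range ⊓ f.ker).relIndex f.ker =
      Nat.card f.ker := by
    rw [← AddSubgroup.relIndex_bot_left, ← AddSubgroup.relIndex_bot_left,
      AddSubgroup.relIndex_mul_relIndex _ _ _ bot_le inf_le_right]
  have h4 : Nat.card (f.comp g).ker =
      Nat.card g.ker * Nat.card (g.range ⊓ f.ker : AddSubgroup M) := by
    have hle : g.ker ≤ (f.comp g).ker := fun x hx => by
      rw [AddMonoidHom.mem_ker] at hx ⊢; simp [hx]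
    have hmap : (f.comp g).ker.map g = g.range ⊓ f.ker := by
      ext y
      constructor
      · rintro ⟨x, hx, rfl⟩
        exact ⟨⟨x, rfl⟩, hx⟩
      · rintro ⟨⟨x, rfl⟩, hx⟩
        exact ⟨x, hx, rfl⟩
    rw [← hmap, ← AddSubgroup.relIndex_ker, ← AddSubgroup.relIndex_bot_left,
      ← AddSubgroup.relIndex_bot_left, AddSubgroup.relIndex_mul_relIndex _ _ _ bot_le hle]
  rw [h1, ← h2, ← h3, h4]
  ring

/-- The iterated form of `index_range_comp`. Only finiteness of the kernel is needed, as the index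
of a subgroup of infinite index is zero. -/
theorem index_range_pow {M : Type*} [AddCommGroup M] (f : Module.End ℤ M) (k : ℕ)
    (hfin : Finite (f ^ k).toAddMonoidHom.ker) :
    (f ^ k).toAddMonoidHom.range.index * Nat.card f.toAddMonoidHom.ker ^ k =
      f.toAddMonoidHom.range.index ^ k * Nat.card (f ^ k).toAddMonoidHom.ker := by
  induction k with
  | zero =>
    have h1 : (f ^ 0).toAddMonoidHom.range = ⊤ := AddMonoidHom.range_eq_top.mpr fun x => ⟨x, rfl⟩
    have h2 : (f ^ 0).toAddMonoidHom.ker = ⊥ :=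
      (AddMonoidHom.ker_eq_bot_iff _).mpr fun _ _ h => h
    rw [h1, h2]
    simp
  | succ k ih =>
    have hle : (f ^ k).toAddMonoidHom.ker ≤ (f ^ (k + 1)).toAddMonoidHom.ker := fun x hx => by
      rw [AddMonoidHom.mem_ker] at hx ⊢
      rw [pow_succ']
      change f ((f ^ k) x) = 0
      rw [show (f ^ k) x = 0 from hx, map_zero]
    have hfin' : Finite (f ^ k).toAddMonoidHom.ker :=
      Finite.of_injective _ (AddSubgroup.inclusion_injective hle)
    have h1 := ih hfin'
    have h2 := index_range_comp (f ^ k).toAddMonoidHom f.toAddMonoidHom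
    have h3 : (f ^ k).toAddMonoidHom.comp f.toAddMonoidHom = (f ^ (k + 1)).toAddMonoidHom := by
      rw [pow_succ]; rfl
    rw [h3] at h2
    have h4 : Nat.card (f ^ k).toAddMonoidHom.ker ≠ 0 := Nat.card_pos.ne'
    apply mul_left_cancel₀ h4
    calc _ = ((f ^ (k + 1)).toAddMonoidHom.range.index * Nat.card (f ^ k).toAddMonoidHom.ker
          * Nat.card f.toAddMonoidHom.ker) * Nat.card f.toAddMonoidHom.ker ^ k := by ring
      _ = ((f ^ k).toAddMonoidHom.range.index * Nat.card f.toAddMonoidHom.ker ^ k)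
          * f.toAddMonoidHom.range.index * Nat.card (f ^ (k + 1)).toAddMonoidHom.ker := by
        rw [h2]; ring
      _ = _ := by rw [h1]; ring

theorem finite_ker_nsmul (M : Type*) [AddCommGroup M] [Module.Finite ℤ M] {n : ℕ} (hn : n ≠ 0) :
    Finite (nsmulAddMonoidHom n : M →+ M).ker := by
  have : Finite (Submodule.torsion ℤ M) :=
    Module.finite_of_fg_torsion _ (Submodule.torsion_isTorsion)
  refine Finite.of_injective (β := Submodule.torsion ℤ M) (fun x => ⟨x.1, ?_⟩)
    fun x y h => Subtype.ext (Subtype.mk.inj h)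
  rw [Submodule.mem_torsion_iff]
  exact ⟨⟨n, mem_nonZeroDivisors_of_ne_zero (by exact_mod_cast hn)⟩, by
    have := x.2
    rw [AddMonoidHom.mem_ker, nsmulAddMonoidHom_apply] at this
    simpa [Submonoid.smul_def] using this⟩

/-- For a finitely generated abelian group `M` of rank `r`, `[M : n M] = n ^ r * |M[n]|`. -/
theorem index_range_nsmul_eq (M : Type*) [AddCommGroup M] [Module.Finite ℤ M] {n : ℕ}
    (hn : n ≠ 0) :
    (nsmulAddMonoidHom n : M →+ M).range.index =
      n ^ finrank ℤ M * Nat.card (nsmulAddMonoidHom n : M →+ M).ker := by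
  set f : M →+ M := nsmulAddMonoidHom n with hf
  have : Finite (Submodule.torsion ℤ M) :=
    Module.finite_of_fg_torsion _ (Submodule.torsion_isTorsion)
  set T : Submodule ℤ M := Submodule.torsion ℤ M with hT
  have hmemT : ∀ x : M, n • x ∈ T → x ∈ T := fun x hx => by
    rw [hT, Submodule.mem_torsion_iff] at hx ⊢
    obtain ⟨a, ha⟩ := hx
    refine ⟨a * ⟨n, mem_nonZeroDivisors_of_ne_zero (by exact_mod_cast hn)⟩, ?_⟩
    rw [mul_smul]
    simpa [Submonoid.smul_def] using ha
  have hquot : (f.range ⊔ T.toAddSubgroup).index = n ^ finrank ℤ M := by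
    have h1 := AddSubgroup.index_map f.range T.mkQ.toAddMonoidHom
    have h2 : T.mkQ.toAddMonoidHom.range = ⊤ :=
      AddMonoidHom.range_eq_top.mpr T.mkQ_surjective
    have h3 : T.mkQ.toAddMonoidHom.ker = T.toAddSubgroup := by
      ext x; simp [AddMonoidHom.mem_ker]
    have h4 : f.range.map T.mkQ.toAddMonoidHom = (nsmulAddMonoidHom n : M ⧸ T →+ M ⧸ T).range := by
      ext y
      constructor
      · rintro ⟨_, ⟨x, rfl⟩, rfl⟩
        exact ⟨T.mkQ x, by simp [hf]⟩
      · rintro ⟨x, rfl⟩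
        obtain ⟨x, rfl⟩ := T.mkQ_surjective x
        exact ⟨n • x, ⟨x, rfl⟩, by simp⟩
    rw [h2, AddSubgroup.index_top, mul_one, h3, h4, AddSubgroup.index_range_nsmul] at h1
    rw [← h1, finrank_quotient_eq_of_le_torsion le_rfl]
  have htors : f.range.relIndex T.toAddSubgroup = Nat.card f.ker := by
    have h1 : (f.range ⊓ T.toAddSubgroup) = T.toAddSubgroup.map f := by
      ext y
      constructor
      · rintro ⟨⟨x, rfl⟩, hx⟩
        exact ⟨x, hmemT x hx, rfl⟩
      · rintro ⟨x, hx, rfl⟩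
        exact ⟨⟨x, rfl⟩, T.toAddSubgroup.nsmul_mem hx n⟩
    have hfinT : Finite T.toAddSubgroup := this
    rw [← AddSubgroup.inf_relIndex_right, h1, AddSubgroup.relIndex,
      AddSubgroup.addSubgroupOf_map_nsmulAddMonoidHom_eq_range, AddSubgroup.index_range]
    refine Nat.card_congr (Equiv.ofBijective (fun x => ⟨x.1.1, ?_⟩) ⟨fun x y h => ?_, fun y => ?_⟩)
    · have := x.2
      rw [AddMonoidHom.mem_ker, nsmulAddMonoidHom_apply] at this ⊢
      simpa using congrArg Subtype.val this
    · exact Subtype.ext (Subtype.ext (Subtype.mk.inj h))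
    · have hy := y.2
      rw [AddMonoidHom.mem_ker, nsmulAddMonoidHom_apply] at hy
      exact ⟨⟨⟨y.1, hmemT _ (by rw [hy]; exact T.zero_mem)⟩, by
        rw [AddMonoidHom.mem_ker, nsmulAddMonoidHom_apply]; exact Subtype.ext hy⟩, rfl⟩
  rw [← hquot, ← htors, ← AddSubgroup.relIndex_sup_right, sup_comm T.toAddSubgroup, mul_comm,
    AddSubgroup.relIndex_mul_index le_sup_left]

/-- In a commutative ring in which `1 + t + ⋯ + t ^ (p - 1) = 0`, the elements `(t - 1) ^ (p - 1)`
and `p` are associated. Indeed `(t - 1) ^ (p - 1) = -p v` with `v ≡ 1` modulo `t - 1`. -/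
theorem exists_unit_sub_one_pow {R : Type*} [CommRing R] {p : ℕ} (hp : p.Prime) (t : R)
    (ht : ∑ i ∈ Finset.range p, t ^ i = 0) : ∃ u : Rˣ, (p : R) * u = (t - 1) ^ (p - 1) := by
  have hp2 := hp.two_le
  obtain ⟨g, hg⟩ : ∃ g : R, (t - 1) ^ (p - 1) = p * (-(1 + (t - 1) * g)) := by
    have h := congrArg (Polynomial.eval (t - 1)) (geom_sum_X_comp_X_add_one_eq_sum (R := R) p)
    simp only [eval_comp, eval_finsetSum, eval_pow, eval_X, eval_add, eval_one, sub_add_cancel,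
      eval_mul, eval_natCast] at h
    rw [ht] at h
    obtain ⟨q, rfl⟩ : ∃ q, p = q + 1 + 1 := ⟨p - 2, by omega⟩
    rw [Finset.sum_range_succ, Finset.sum_range_succ'] at h
    have hdvd : ∀ i ∈ Finset.range q, ∃ c : ℕ, (q + 1 + 1).choose (i + 1 + 1) = (q + 1 + 1) * c :=
      fun i hi => hp.dvd_choose_self (by omega) (by have := Finset.mem_range.mp hi; omega)
    choose! c hc using hdvd
    refine ⟨∑ i ∈ Finset.range q, c i * (t - 1) ^ i, ?_⟩
    rw [Finset.sum_congr rfl fun i hi => by rw [hc i hi]] at h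
    have h5 : ∑ i ∈ Finset.range q, (((q + 1 + 1) * c i : ℕ) : R) * (t - 1) ^ (i + 1) =
        ((q + 1 + 1 : ℕ) : R) * ((t - 1) * ∑ i ∈ Finset.range q, c i * (t - 1) ^ i) := by
      rw [Finset.mul_sum, Finset.mul_sum]
      exact Finset.sum_congr rfl fun i _ => by push_cast; ring
    rw [h5] at h
    simp only [Nat.choose_self, zero_add, Nat.choose_one_right, pow_zero, Nat.cast_one] at h
    have h6 : q + 1 + 1 - 1 = q + 1 := by omega
    rw [h6]
    linear_combination -h
  have hunit : IsUnit (-(1 + (t - 1) * g)) := by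
    have hcop : IsCoprime (-(1 + (t - 1) * g)) ((t - 1) ^ (p - 1)) :=
      IsCoprime.pow_right ⟨-1, -g, by ring⟩
    exact hcop.isUnit_of_dvd' dvd_rfl ⟨p, by rw [hg]; ring⟩
  exact ⟨hunit.unit, hg.symm⟩

/-- The variant of `exists_unit_sub_one_pow` for a ring that need not be commutative, obtained from
the subring generated by `s`. -/
theorem exists_unit_sub_one_pow_of_ring {S : Type*} [Ring S] {p : ℕ} (hp : p.Prime) (s : S)
    (hs : ∑ i ∈ Finset.range p, s ^ i = 0) : ∃ u : Sˣ, (p : S) * u = (s - 1) ^ (p - 1) := by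
  let I : Ideal ℤ[X] := Ideal.span {∑ i ∈ Finset.range p, X ^ i}
  let φ : ℤ[X] ⧸ I →+* S := Ideal.Quotient.lift I (aeval s : ℤ[X] →ₐ[ℤ] S).toRingHom fun a ha => by
    obtain ⟨b, rfl⟩ := Ideal.mem_span_singleton.mp ha
    change aeval s _ = 0
    rw [map_mul, map_sum]
    simp [hs]
  obtain ⟨u, hu⟩ := exists_unit_sub_one_pow hp (Ideal.Quotient.mk I X) (by
    have h : Ideal.Quotient.mk I (∑ i ∈ Finset.range p, X ^ i) = 0 :=
      Ideal.Quotient.eq_zero_iff_mem.mpr (Ideal.mem_span_singleton_self _)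
    rw [← h, map_sum]
    exact Finset.sum_congr rfl fun i _ => (map_pow _ _ _).symm)
  refine ⟨Units.map φ.toMonoidHom u, ?_⟩
  have hX : φ (Ideal.Quotient.mk I X) = s := by
    change aeval s X = s
    simp
  have := congrArg φ hu
  rwa [map_mul, map_pow, map_sub, map_one, map_natCast, hX] at this

/-- If `1 + s + ⋯ + s ^ (p - 1) = 0` on a finitely generated abelian group `M` of rank
`m * (p - 1)`, then `[M : (s - 1) M] = p ^ m * |ker (s - 1)|`. This compares `(s - 1) ^ (p - 1)`
with multiplication by `p`. -/
theorem index_range_sub_one {M : Type*} [AddCommGroup M] [Module.Finite ℤ M] {p : ℕ}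
    (hp : p.Prime) (s : Module.End ℤ M) (hs : ∑ i ∈ Finset.range p, s ^ i = 0) {m : ℕ}
    (hm : finrank ℤ M = m * (p - 1)) :
    (s - 1).toAddMonoidHom.range.index = p ^ m * Nat.card (s - 1).toAddMonoidHom.ker := by
  obtain ⟨u, hu⟩ := exists_unit_sub_one_pow_of_ring hp s hs
  have huapp : ∀ x, (u : Module.End ℤ M) ((↑u⁻¹ : Module.End ℤ M) x) = x := fun x => by
    rw [← Module.End.mul_apply, Units.mul_inv, Module.End.one_apply]
  have huapp' : ∀ x, (↑u⁻¹ : Module.End ℤ M) ((u : Module.End ℤ M) x) = x := fun x => by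
    rw [← Module.End.mul_apply, Units.inv_mul, Module.End.one_apply]
  have happ : ∀ x, ((s - 1) ^ (p - 1)) x = p • (u : Module.End ℤ M) x := fun x => by
    rw [← hu, Module.End.mul_apply, Module.End.natCast_apply]
  have hrange : ((s - 1) ^ (p - 1)).toAddMonoidHom.range =
      (nsmulAddMonoidHom p : M →+ M).range := by
    ext y
    constructor
    · rintro ⟨x, rfl⟩
      exact ⟨(u : Module.End ℤ M) x, (happ x).symm⟩
    · rintro ⟨x, rfl⟩
      refine ⟨(↑u⁻¹ : Module.End ℤ M) x, ?_⟩
      change ((s - 1) ^ (p - 1)) _ = p • x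
      rw [happ, huapp]
  have hker : ((s - 1) ^ (p - 1)).toAddMonoidHom.ker = (nsmulAddMonoidHom p : M →+ M).ker := by
    ext x
    rw [AddMonoidHom.mem_ker, AddMonoidHom.mem_ker]
    change ((s - 1) ^ (p - 1)) x = 0 ↔ p • x = 0
    rw [happ, ← map_nsmul]
    exact ⟨fun h => by rw [← huapp' (p • x), h, map_zero], fun h => by rw [h, map_zero]⟩
  have hfin := finite_ker_nsmul M hp.ne_zero
  have hcard : Nat.card (nsmulAddMonoidHom p : M →+ M).ker ≠ 0 := Nat.card_pos.ne'
  have h := index_range_pow (s - 1) (p - 1) (hker ▸ hfin)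
  rw [hrange, hker, index_range_nsmul_eq M hp.ne_zero, hm, pow_mul] at h
  have h2 : (p ^ m * Nat.card (s - 1).toAddMonoidHom.ker) ^ (p - 1) =
      (s - 1).toAddMonoidHom.range.index ^ (p - 1) := by
    apply mul_right_cancel₀ hcard
    rw [← h]
    ring
  have := hp.two_le
  exact (Nat.pow_left_injective (by omega : p - 1 ≠ 0) h2).symm

/-- The Herbrand quotient of a finitely generated abelian group `M` with an action of a cyclic
group `⟨s⟩` of prime order `p`, in case `rank M + 1 = p (rank M ^ s + 1)`: the order of
`ker N / (s - 1) M` is `p` times that of `M ^ s / N M`, where `N = 1 + s + ⋯ + s ^ (p - 1)`. -/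
theorem relIndex_range_sub_one_eq {M : Type*} [AddCommGroup M] [Module.Finite ℤ M] {p : ℕ}
    (hp : p.Prime) (s : Module.End ℤ M) (hs : s ^ p = 1)
    (N : Module.End ℤ M) (hN : N = ∑ i ∈ Finset.range p, s ^ i)
    (hrank : finrank ℤ M + 1 = p * (finrank ℤ (LinearMap.ker (s - 1)) + 1)) :
    (s - 1).toAddMonoidHom.range.relIndex N.toAddMonoidHom.ker =
      p * N.toAddMonoidHom.range.relIndex (s - 1).toAddMonoidHom.ker := by
  have hNd : N * (s - 1) = 0 := by rw [hN, geom_sum_mul, hs, sub_self]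
  have hdN : (s - 1) * N = 0 := by rw [hN, mul_geom_sum, hs, sub_self]
  have hNfix : ∀ x, (s - 1) x = 0 → N x = p • x := fun x hx => by
    have h1 : s x = x := by simpa [sub_eq_zero] using hx
    have h2 : ∀ i : ℕ, (s ^ i) x = x := fun i => by
      induction i with
      | zero => rfl
      | succ i ih => rw [pow_succ', Module.End.mul_apply, ih, h1]
    rw [hN, LinearMap.sum_apply, Finset.sum_congr rfl fun i _ => h2 i]
    simp
  -- the ranks
  have hrk0 : finrank ℤ (LinearMap.range N) = finrank ℤ (LinearMap.ker (s - 1)) := by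
    refine le_antisymm (Submodule.finrank_mono ?_) ?_
    · rintro _ ⟨x, rfl⟩
      rw [LinearMap.mem_ker, ← Module.End.mul_apply, hdN, LinearMap.zero_apply]
    · have hle : (LinearMap.ker (s - 1)).map ((p : ℤ) • LinearMap.id) ≤ LinearMap.range N := by
        rintro _ ⟨x, hx, rfl⟩
        exact ⟨x, by simpa using hNfix x hx⟩
      refine le_trans ?_ (Submodule.finrank_mono hle)
      have := (LinearMap.ker ((((p : ℤ) • LinearMap.id : M →ₗ[ℤ] M)).domRestrict
        (LinearMap.ker (s - 1)))).finrank_quotient_add_finrank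
      rw [(LinearMap.quotKerEquivRange _).finrank_eq, LinearMap.range_domRestrict,
        (Module.finrank_eq_zero_iff_isTorsion (M := LinearMap.ker _)).mpr, add_zero] at this
      · exact this.ge
      · intro x
        have hx := x.2
        rw [LinearMap.mem_ker] at hx
        refine ⟨⟨p, mem_nonZeroDivisors_of_ne_zero (by exact_mod_cast hp.ne_zero)⟩, ?_⟩
        apply Subtype.ext
        apply Subtype.ext
        simpa using hx
  have hrk : finrank ℤ (LinearMap.range N) + finrank ℤ (LinearMap.ker N) = finrank ℤ M := by
    rw [← (LinearMap.ker N).finrank_quotient_add_finrank,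
      (LinearMap.quotKerEquivRange N).finrank_eq]
  set r := finrank ℤ (LinearMap.ker (s - 1)) with hr
  have hrk1 : finrank ℤ (LinearMap.ker N) = (r + 1) * (p - 1) := by
    obtain ⟨q, rfl⟩ : ∃ q, p = q + 1 := ⟨p - 1, by have := hp.two_le; omega⟩
    simp only [Nat.add_sub_cancel]
    rw [hrk0] at hrk
    nlinarith
  -- the index of `(s - 1) (ker N)` in `ker N`
  have hmaps : ∀ x ∈ LinearMap.ker N, s x ∈ LinearMap.ker N := fun x hx => by
    have : N * s = s * N := by
      rw [mul_sub, mul_one, sub_eq_zero] at hNd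
      rw [sub_mul, one_mul, sub_eq_zero] at hdN
      rw [hNd, hdN]
    rw [LinearMap.mem_ker] at hx ⊢
    rw [← Module.End.mul_apply, this, Module.End.mul_apply, hx, map_zero]
  let s' : Module.End ℤ (LinearMap.ker N) := s.restrict hmaps
  have hs'pow : ∀ (i : ℕ) x, ((s' ^ i) x : M) = (s ^ i) x := fun i x => by
    induction i with
    | zero => rfl
    | succ i ih =>
      rw [pow_succ', Module.End.mul_apply, pow_succ', Module.End.mul_apply, ← ih]
      rfl
  have hs' : ∑ i ∈ Finset.range p, s' ^ i = 0 := by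
    ext x
    rw [LinearMap.sum_apply, AddSubmonoidClass.coe_finsetSum,
      Finset.sum_congr rfl fun i _ => hs'pow i x, ← LinearMap.sum_apply, ← hN]
    exact x.2
  have hidx := index_range_sub_one hp s' hs' hrk1
  set d : M →+ M := (s - 1).toAddMonoidHom with hd
  set n : M →+ M := N.toAddMonoidHom with hn
  have hd' : ∀ x : LinearMap.ker N, (((s' - 1) x : LinearMap.ker N) : M) = d x := fun x => rfl
  have hX : (s' - 1).toAddMonoidHom.range.index = (n.ker.map d).relIndex n.ker := by
    rw [← AddSubgroup.relIndex_top_right, ← AddSubgroup.relIndex_map_map_of_injective _ _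
      (f := (LinearMap.ker N).subtype.toAddMonoidHom) Subtype.val_injective]
    congr 1
    · ext y
      constructor
      · rintro ⟨_, ⟨x, rfl⟩, rfl⟩
        exact ⟨x, x.2, (hd' x).symm⟩
      · rintro ⟨x, hx, rfl⟩
        exact ⟨_, ⟨⟨x, hx⟩, rfl⟩, hd' ⟨x, hx⟩⟩
    · ext y
      constructor
      · rintro ⟨x, -, rfl⟩
        exact x.2
      · intro hy
        exact ⟨⟨y, hy⟩, trivial, rfl⟩
  have hcard : Nat.card (s' - 1).toAddMonoidHom.ker =
      Nat.card (nsmulAddMonoidHom p : LinearMap.ker (s - 1) →+ LinearMap.ker (s - 1)).ker := by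
    refine Nat.card_congr
      { toFun := fun x => ⟨⟨x.1.1, ?_⟩, ?_⟩
        invFun := fun x => ⟨⟨x.1.1, ?_⟩, ?_⟩
        left_inv := fun x => rfl
        right_inv := fun x => rfl }
    · exact congrArg Subtype.val x.2
    · have h1 : (s - 1) x.1.1 = 0 := congrArg Subtype.val x.2
      have h2 : N x.1.1 = 0 := x.1.2
      rw [hNfix _ h1] at h2
      exact Subtype.ext h2
    · have h2 : p • x.1.1 = 0 := congrArg Subtype.val x.2
      rw [LinearMap.mem_ker, hNfix _ x.1.2, h2]
    · exact Subtype.ext x.1.2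
  -- the index of `p (ker (s - 1)) = N (ker (s - 1))` in `ker (s - 1)`
  have hK := index_range_nsmul_eq (LinearMap.ker (s - 1)) hp.ne_zero
  have hK' : (nsmulAddMonoidHom p : LinearMap.ker (s - 1) →+ LinearMap.ker (s - 1)).range.index =
      (d.ker.map n).relIndex d.ker := by
    rw [← AddSubgroup.relIndex_top_right, ← AddSubgroup.relIndex_map_map_of_injective _ _
      (f := (LinearMap.ker (s - 1)).subtype.toAddMonoidHom) Subtype.val_injective]
    congr 1
    · ext y
      constructor
      · rintro ⟨_, ⟨x, rfl⟩, rfl⟩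
        exact ⟨x, x.2, hNfix x x.2⟩
      · rintro ⟨x, hx, rfl⟩
        exact ⟨_, ⟨⟨x, hx⟩, rfl⟩, (hNfix x hx).symm⟩
    · ext y
      constructor
      · rintro ⟨x, -, rfl⟩
        exact x.2
      · intro hy
        exact ⟨⟨y, hy⟩, trivial, rfl⟩
  have hle1 : d.range ≤ n.ker := by
    rintro _ ⟨x, rfl⟩
    change N ((s - 1) x) = 0
    rw [← Module.End.mul_apply, hNd, LinearMap.zero_apply]
  have hle2 : n.range ≤ d.ker := by
    rintro _ ⟨x, rfl⟩
    change (s - 1) (N x) = 0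
    rw [← Module.End.mul_apply, hdN, LinearMap.zero_apply]
  -- the indices of `d (ker n)` in `d M` and of `n (ker d)` in `n M` both equal that of
  -- `ker d + ker n` in `M`
  have e1 : (n.ker.map d).relIndex d.range * d.range.relIndex n.ker =
      (n.ker.map d).relIndex n.ker :=
    AddSubgroup.relIndex_mul_relIndex _ _ _ (AddSubgroup.map_le_range _ _) hle1
  have e2 : (d.ker.map n).relIndex n.range * n.range.relIndex d.ker =
      (d.ker.map n).relIndex d.ker :=
    AddSubgroup.relIndex_mul_relIndex _ _ _ (AddSubgroup.map_le_range _ _) hle2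
  have e3 : (n.ker.map d).relIndex d.range = (d.ker.map n).relIndex n.range := by
    rw [AddMonoidHom.range_eq_map, AddMonoidHom.range_eq_map, AddSubgroup.relIndex_map_map,
      AddSubgroup.relIndex_map_map, sup_comm, top_sup_eq, top_sup_eq]
  have hfin := finite_ker_nsmul (LinearMap.ker (s - 1)) hp.ne_zero
  have hpos : Nat.card (nsmulAddMonoidHom p : LinearMap.ker (s - 1) →+ LinearMap.ker (s - 1)).ker
      ≠ 0 := Nat.card_pos.ne'
  rw [hX, hcard, ← e1, e3] at hidx
  rw [hK', ← e2] at hK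
  have hne : (d.ker.map n).relIndex n.range ≠ 0 := by
    intro h0
    rw [h0, zero_mul] at hK
    exact mul_ne_zero (pow_ne_zero _ hp.ne_zero) hpos hK.symm
  apply mul_left_cancel₀ hne
  rw [hidx, mul_left_comm, hK, pow_succ]
  ring

end Herbrand

/-! ### Principal ideals extended from a subfield -/

section PrincipalIdeals

open Pointwise

theorem exists_int_mul_eq_integer {F : Type*} [Field F] [NumberField F] (α : F) :
    ∃ d : ℤ, d ≠ 0 ∧ ∃ x : 𝓞 F, (x : F) = d * α := by
  obtain ⟨m, hm⟩ := IsIntegral.exists_multiple_integral_of_isLocalization ℤ⁰ α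
    (Algebra.IsIntegral.isIntegral (R := ℚ) α)
  refine ⟨m, nonZeroDivisors.coe_ne_zero m, ⟨m • α, hm⟩, ?_⟩
  exact zsmul_eq_mul α (m : ℤ)

theorem smul_span_singleton {G B : Type*} [Group G] [CommRing B] [MulSemiringAction G B] (g : G)
    (x : B) : g • Ideal.span {x} = Ideal.span {g • x} := by
  simp only [Ideal.pointwise_smul_def, Ideal.map_span, MulSemiringAction.toRingHom_apply,
    Set.image_singleton]

theorem smul_map_algebraMap {A B G : Type*} [CommRing A] [CommRing B] [Algebra A B] [Group G]
    [MulSemiringAction G B] [SMulCommClass G A B] (g : G) (I : Ideal A) :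
    g • I.map (algebraMap A B) = I.map (algebraMap A B) := by
  rw [Ideal.pointwise_smul_def, Ideal.map_map]
  congr 1
  ext a
  exact smul_algebraMap g a

variable {E F : Type*} [Field E] [NumberField E] [Field F] [NumberField F] [Algebra E F]

theorem extendIdeals_toPrincipalIdeal (x : Eˣ) :
    extendIdeals E F (toPrincipalIdeal (𝓞 E) E x) =
      toPrincipalIdeal (𝓞 F) F (Units.map (algebraMap E F).toMonoidHom x) := by
  ext1
  simp only [extendIdeals, Units.coe_map, coe_toPrincipalIdeal]
  refine (FractionalIdeal.extendedHom_spanSingleton (A := 𝓞 E) (K := E) F (𝓞 F) _).trans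
    (congrArg _ (DFunLike.congr_fun (f := IsFractionRing.map _) (g := algebraMap E F)
      (IsLocalization.ringHom_ext (𝓞 E)⁰ (RingHom.ext fun a => ?_)) (x : E)))
  rw [RingHom.comp_apply, RingHom.comp_apply, IsFractionRing.map, IsLocalization.map_eq,
    ← IsScalarTower.algebraMap_apply, ← IsScalarTower.algebraMap_apply]

theorem coe_extendIdeals_mk0 (I : (Ideal (𝓞 E))⁰) :
    (extendIdeals E F (FractionalIdeal.mk0 E I) : FractionalIdeal (𝓞 F)⁰ F) =
      (I.1.map (algebraMap (𝓞 E) (𝓞 F)) : Ideal (𝓞 F)) := by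
  simp only [extendIdeals, Units.coe_map, FractionalIdeal.coe_mk0]
  exact FractionalIdeal.extendedHom_coeIdeal_eq_map F (𝓞 F) _

theorem extendIdeals_mk0 (I : (Ideal (𝓞 E))⁰) :
    extendIdeals E F (FractionalIdeal.mk0 E I) =
      FractionalIdeal.mk0 F (ClassGroup.extendedIdeal (𝓞 E) (𝓞 F) I) := by
  ext1
  rw [coe_extendIdeals_mk0, FractionalIdeal.coe_mk0]

theorem extendIdeals_injective : Function.Injective (extendIdeals E F) := fun _ _ h =>
  Units.ext (FractionalIdeal.extendedHom_injective (A := 𝓞 E) (K := E) F (𝓞 F)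
    (congrArg Units.val h))

/-- Every fractional ideal becomes integral after multiplication with a principal ideal. -/
theorem exists_toPrincipalIdeal_mul_eq_mk0 (a : Ideals E) :
    ∃ (d : Eˣ) (I : (Ideal (𝓞 E))⁰),
      toPrincipalIdeal (𝓞 E) E d * a = FractionalIdeal.mk0 E I := by
  have hd : algebraMap (𝓞 E) E (a : FractionalIdeal (𝓞 E)⁰ E).den ≠ 0 := by
    rw [Ne, FaithfulSMul.algebraMap_eq_zero_iff]
    exact nonZeroDivisors.coe_ne_zero _
  refine ⟨Units.mk0 _ hd, ⟨(a : FractionalIdeal (𝓞 E)⁰ E).num, ?_⟩, ?_⟩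
  · rw [mem_nonZeroDivisors_iff_ne_zero]
    exact fun h => a.ne_zero (FractionalIdeal.num_eq_zero_iff.mp h)
  · ext1
    rw [Units.val_mul, coe_toPrincipalIdeal, FractionalIdeal.coe_mk0, Units.val_mk0]
    exact FractionalIdeal.den_mul_self_eq_num' (𝓞 E)⁰ E _

/-- The generators of the unit ideal are the units of the ring of integers. -/
theorem toPrincipalIdeal_eq_one_iff (x : Eˣ) :
    toPrincipalIdeal (𝓞 E) E x = 1 ↔ ∃ u : (𝓞 E)ˣ, (u : E) = x := by
  rw [toPrincipalIdeal_eq_iff, Units.val_one, ← FractionalIdeal.spanSingleton_one, eq_comm,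
    FractionalIdeal.spanSingleton_eq_spanSingleton]
  refine exists_congr fun u => ?_
  rw [Units.smul_def, Algebra.smul_def, mul_one]

theorem coe_span_singleton_eq (x : 𝓞 E) (y : Eˣ) (h : (x : E) = y) :
    ((Ideal.span {x} : Ideal (𝓞 E)) : FractionalIdeal (𝓞 E)⁰ E) =
      toPrincipalIdeal (𝓞 E) E y := by
  rw [coe_toPrincipalIdeal, FractionalIdeal.coeIdeal_span_singleton]
  exact congrArg _ h

/-- A principal ideal `(α)` of `N` extended from `K` is Galois invariant: all quotients `g α / α`
are units. -/
theorem exists_unit_of_toPrincipalIdeal_mem_range {K N : Type*} [Field K] [NumberField K] [Field N]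
    [NumberField N] [Algebra K N] [IsGalois K N] {α : Nˣ}
    (hα : toPrincipalIdeal (𝓞 N) N α ∈ (extendIdeals K N).range) (g : Gal(N/K)) :
    ∃ u : (𝓞 N)ˣ, g α = u * α := by
  obtain ⟨a, ha⟩ := hα
  obtain ⟨d, I, hI⟩ := exists_toPrincipalIdeal_mul_eq_mk0 a
  have h1 := congrArg (extendIdeals K N) hI
  rw [map_mul, ha, extendIdeals_toPrincipalIdeal, ← map_mul] at h1
  set β : Nˣ := Units.map (algebraMap K N).toMonoidHom d * α with hβ
  have h2 := congrArg Units.val h1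
  rw [coe_extendIdeals_mk0] at h2
  obtain ⟨x, hx⟩ : ∃ x : 𝓞 N, (x : N) = β := by
    have h3 : (β : N) ∈ (toPrincipalIdeal (𝓞 N) N β : FractionalIdeal (𝓞 N)⁰ N) := by
      rw [coe_toPrincipalIdeal]; exact FractionalIdeal.mem_spanSingleton_self _ _
    rw [h2, FractionalIdeal.mem_coeIdeal] at h3
    obtain ⟨x, -, hx⟩ := h3
    exact ⟨x, hx⟩
  rw [← coe_span_singleton_eq x β hx, FractionalIdeal.coeIdeal_inj] at h2
  have h4 := congrArg (g • ·) h2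
  have : SMulCommClass Gal(N/K) (𝓞 K) (𝓞 N) :=
    (inferInstance : IsGaloisGroup Gal(N/K) (𝓞 K) (𝓞 N)).commutes
  rw [smul_span_singleton, smul_map_algebraMap, ← h2, Ideal.span_singleton_eq_span_singleton] at h4
  obtain ⟨u, hu⟩ := h4.symm
  refine ⟨u, ?_⟩
  have h5 : (x : N) * u = g x := congrArg (algebraMap (𝓞 N) N) hu
  rw [hx, hβ, Units.val_mul, map_mul] at h5
  have h6 : g (Units.map (algebraMap K N).toMonoidHom d : Nˣ) =
      (Units.map (algebraMap K N).toMonoidHom d : Nˣ) := g.commutes _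
  rw [h6, mul_assoc] at h5
  rw [mul_comm, mul_left_cancel₀ (Units.ne_zero _) h5]

/-- If all ramification indices of `N/K` divide `m`, then the `m`-th powers of Galois invariant
principal ideals are extended from `K`. -/
theorem toPrincipalIdeal_pow_mem_range {K N : Type*} [Field K] [NumberField K] [Field N]
    [NumberField N] [Algebra K N] [IsGalois K N]
    {m : ℕ} (hm : ∀ P : Ideal (𝓞 N), P.IsPrime → P ≠ ⊥ → P.ramificationIdx (𝓞 K) ∣ m) {α : Nˣ}
    (hα : ∀ g : Gal(N/K), ∃ u : (𝓞 N)ˣ, g α = u * α) :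
    toPrincipalIdeal (𝓞 N) N α ^ m ∈ (extendIdeals K N).range := by
  obtain ⟨d, hd, x, hx⟩ := exists_int_mul_eq_integer (α : N)
  have hx0 : x ≠ 0 := fun h => by
    rw [h] at hx
    exact mul_ne_zero (Int.cast_ne_zero.mpr hd) α.ne_zero hx.symm
  obtain ⟨b, hb⟩ := exists_map_eq_pow_of_forall_smul_eq (A := 𝓞 K) Gal(N/K) hm (Ideal.span {x})
    (by rwa [Ne, Ideal.span_singleton_eq_bot]) (fun g => by
      rw [smul_span_singleton, Ideal.span_singleton_eq_span_singleton]
      obtain ⟨u, hu⟩ := hα g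
      refine (Associated.symm ⟨u, ?_⟩)
      ext
      change (x : N) * u = g x
      rw [hx, map_mul, map_intCast, hu]
      ring)
  have hb0 : b ≠ ⊥ := by
    rintro rfl
    rw [Ideal.map_bot] at hb
    exact hx0 (Ideal.span_singleton_eq_bot.mp (eq_zero_of_pow_eq_zero hb.symm))
  let d' : Kˣ := Units.mk0 (d : K) (Int.cast_ne_zero.mpr hd)
  refine ⟨FractionalIdeal.mk0 K ⟨b, mem_nonZeroDivisors_iff_ne_zero.mpr hb0⟩ *
    ((toPrincipalIdeal (𝓞 K) K d') ^ m)⁻¹, ?_⟩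
  rw [map_mul, map_inv, map_pow, mul_inv_eq_iff_eq_mul, extendIdeals_toPrincipalIdeal, ← mul_pow,
    ← map_mul]
  ext1
  rw [coe_extendIdeals_mk0, hb, FractionalIdeal.coeIdeal_pow, Units.val_pow_eq_pow_val]
  congr 1
  refine coe_span_singleton_eq x _ ?_
  rw [hx, Units.val_mul, mul_comm]
  congr 1
  simp [d']

/-- If `N/K` is unramified at all finite primes, then Galois invariant principal ideals are
extended from `K`. -/
theorem toPrincipalIdeal_mem_range {K N : Type*} [Field K] [NumberField K] [Field N]
    [NumberField N] [Algebra K N] [IsGalois K N]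
    (hunr : ∀ P : Ideal (𝓞 N), ∀ _ : P.IsPrime, P ≠ ⊥ → Algebra.IsUnramifiedAt (𝓞 K) P) {α : Nˣ}
    (hα : ∀ g : Gal(N/K), ∃ u : (𝓞 N)ˣ, g α = u * α) :
    toPrincipalIdeal (𝓞 N) N α ∈ (extendIdeals K N).range := by
  rw [← pow_one (toPrincipalIdeal (𝓞 N) N α)]
  refine toPrincipalIdeal_pow_mem_range (fun P hP hP0 => ?_) hα
  have := hunr P hP hP0
  rw [Ideal.ramificationIdx_eq_one_of_isUnramifiedAt]

end PrincipalIdeals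

/-! ### Hilbert's Theorem 90 and capitulation -/

section Hilbert90

theorem prod_eq_prod_range_pow {G M : Type*} [Group G] [Fintype G] [CommMonoid M] {g : G}
    (hg : ∀ x, x ∈ Subgroup.zpowers g) (f : G → M) :
    ∏ s, f s = ∏ i ∈ Finset.range (Fintype.card G), f (g ^ i) := by
  classical
  have hord : orderOf g = Fintype.card G := by
    rw [orderOf_eq_card_of_forall_mem_zpowers hg, Nat.card_eq_fintype_card]
  rw [← IsCyclic.image_range_card hg, Finset.prod_image, Nat.card_eq_fintype_card]
  intro i hi j hj h
  rw [Finset.mem_coe, Finset.mem_range, Nat.card_eq_fintype_card, ← hord] at hi hj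
  exact pow_injOn_Iio_orderOf hi hj h

/-- Hilbert's Theorem 90 for a cyclic extension of fields in arbitrary universes. -/
theorem exists_eq_mul_of_norm_eq_one {K L : Type*} [Field K] [Field L] [Algebra K L]
    [FiniteDimensional K L] [IsGalois K L] {g : Gal(L/K)} (hg : ∀ x, x ∈ Subgroup.zpowers g)
    {u : L} (hu : Algebra.norm K u = 1) : ∃ β : Lˣ, g β = u * β := by
  set n := Fintype.card Gal(L/K) with hn
  have hord : orderOf g = n := by
    rw [orderOf_eq_card_of_forall_mem_zpowers hg, Nat.card_eq_fintype_card]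
  -- the partial norms of `u`
  let c : ℕ → L := fun i => ∏ j ∈ Finset.range i, (g ^ j) u
  have hcn : c n = 1 := by
    change ∏ j ∈ Finset.range n, (g ^ j) u = 1
    rw [hn, ← prod_eq_prod_range_pow hg fun s => s u, ← Algebra.norm_eq_prod_automorphisms, hu,
      map_one]
  have hcsucc : ∀ i, c (i + 1) = u * g (c i) := fun i => by
    change ∏ j ∈ Finset.range (i + 1), (g ^ j) u = u * g (∏ j ∈ Finset.range i, (g ^ j) u)
    rw [Finset.prod_range_succ', map_prod, mul_comm]
    congr 1
    exact Finset.prod_congr rfl fun j _ => by rw [pow_succ']; rfl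
  -- Dedekind: the powers of `g` are independent, so some Lagrange resolvent does not vanish
  have hlin : LinearIndependent L (fun i : Fin n => ((g ^ (i : ℕ) : Gal(L/K)) : L → L)) := by
    refine LinearIndependent.comp (ι' := Fin n) (linearIndependent_monoidHom L L)
      (fun i => ((g ^ (i : ℕ) : Gal(L/K)) : L →* L)) fun i j h => ?_
    have h1 : g ^ (i : ℕ) = g ^ (j : ℕ) := AlgEquiv.ext fun x => DFunLike.congr_fun h x
    exact Fin.ext (pow_injOn_Iio_orderOf (i.2.trans_eq hord.symm) (j.2.trans_eq hord.symm) h1)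
  have hnpos : 0 < n := Fintype.card_pos
  obtain ⟨z, hz⟩ : ∃ z, ∑ i ∈ Finset.range n, c i * (g ^ i) z ≠ 0 := by
    by_contra! h
    have := Fintype.linearIndependent_iff.mp hlin (fun i => c i) (by
      ext z
      simpa [Finset.sum_range] using h z) ⟨0, hnpos⟩
    exact one_ne_zero ((Finset.prod_range_zero fun j => (g ^ j) u).symm.trans this)
  have hkey : u * g (∑ i ∈ Finset.range n, c i * (g ^ i) z) =
      ∑ i ∈ Finset.range n, c i * (g ^ i) z := by
    have h1 : u * g (∑ i ∈ Finset.range n, c i * (g ^ i) z) =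
        ∑ i ∈ Finset.range n, c (i + 1) * (g ^ (i + 1)) z := by
      rw [map_sum, Finset.mul_sum]
      refine Finset.sum_congr rfl fun i _ => ?_
      rw [hcsucc, map_mul, pow_succ', mul_assoc]
      rfl
    have h2 := Finset.sum_range_succ (fun i => c i * (g ^ i) z) n
    rw [Finset.sum_range_succ', hcn, ← hord, pow_orderOf_eq_one, hord] at h2
    rw [h1]
    have h3 : c 0 = 1 := Finset.prod_range_zero _
    rw [h3, pow_zero] at h2
    exact add_right_cancel h2
  refine ⟨(Units.mk0 _ hz)⁻¹, ?_⟩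
  rw [Units.val_inv_eq_inv_val, Units.val_mk0, map_inv₀]
  have hgz : g (∑ i ∈ Finset.range n, c i * (g ^ i) z) ≠ 0 :=
    (map_ne_zero g).mpr hz
  rw [eq_mul_inv_iff_mul_eq₀ hz, inv_mul_eq_iff_eq_mul₀ hgz, mul_comm, hkey]

end Hilbert90

section Capitulation

variable (K N : Type*) [Field K] [NumberField K] [Field N] [NumberField N] [Algebra K N]

theorem mk_toPrincipalIdeal (x : Kˣ) : ClassGroup.mk K (toPrincipalIdeal (𝓞 K) K x) = 1 := by
  rw [ClassGroup.mk_eq_one_iff, coe_toPrincipalIdeal, FractionalIdeal.coe_spanSingleton]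
  exact ⟨⟨x, rfl⟩⟩

theorem ker_mk : (ClassGroup.mk (R := 𝓞 K) K).ker = principalIdeals K := by
  ext a
  constructor
  · intro ha
    rw [MonoidHom.mem_ker, ClassGroup.mk_eq_one_iff, FractionalIdeal.isPrincipal_iff] at ha
    obtain ⟨x, hx⟩ := ha
    have hx0 : x ≠ 0 := by
      rintro rfl
      exact a.ne_zero (by rw [hx, FractionalIdeal.spanSingleton_zero])
    exact ⟨Units.mk0 x hx0, by rw [toPrincipalIdeal_eq_iff, hx, Units.val_mk0]⟩
  · rintro ⟨x, rfl⟩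
    exact mk_toPrincipalIdeal K x

theorem extendedHom_classGroupMk (a : Ideals K) :
    ClassGroup.extendedHom (𝓞 K) (𝓞 N) (ClassGroup.mk K a) =
      ClassGroup.mk N (extendIdeals K N a) := by
  obtain ⟨d, I, hI⟩ := exists_toPrincipalIdeal_mul_eq_mk0 a
  have h1 : ClassGroup.mk K a = ClassGroup.mk0 I := by
    rw [← ClassGroup.mk_mk0 K, ← hI, map_mul, mk_toPrincipalIdeal, one_mul]
  have h2 := congrArg (fun b => ClassGroup.mk N (extendIdeals K N b)) hI
  simp only [map_mul, extendIdeals_toPrincipalIdeal, mk_toPrincipalIdeal, one_mul] at h2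
  rw [h1, h2, ClassGroup.extendedHom_mk0, extendIdeals_mk0, ClassGroup.mk_mk0]

/-- The capitulation kernel consists of the classes of those ideals of `K` which become principal
in `N`. -/
theorem card_capitulationKernel_eq_relIndex :
    Nat.card (CapitulationKernel K N) =
      (principalIdeals K).relIndex ((principalIdeals N).comap (extendIdeals K N)) := by
  rw [← ker_mk K, Subgroup.relIndex_ker]
  suffices h : (ClassGroup.extendedHom (𝓞 K) (𝓞 N)).ker =
      ((principalIdeals N).comap (extendIdeals K N)).map (ClassGroup.mk K) by
    rw [CapitulationKernel, h]
  ext c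
  constructor
  · intro hc
    obtain ⟨a, rfl⟩ : ∃ a, ClassGroup.mk K a = c := by
      exact ClassGroup.induction K (fun a => ⟨a, rfl⟩) c
    refine ⟨a, ?_, rfl⟩
    rw [MonoidHom.mem_ker, extendedHom_classGroupMk] at hc
    rw [SetLike.mem_coe, Subgroup.mem_comap, ← ker_mk N]
    exact hc
  · rintro ⟨a, ha, rfl⟩
    rw [SetLike.mem_coe, Subgroup.mem_comap, ← ker_mk N] at ha
    rw [MonoidHom.mem_ker, extendedHom_classGroupMk]
    exact ha

/-- The group of units of `𝓞 F` inside `Fˣ`. -/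
abbrev unitsIn (F : Type*) [Field F] [NumberField F] : (𝓞 F)ˣ →* Fˣ :=
  Units.map (algebraMap (𝓞 F) F).toMonoidHom

/-- The elements of `Nˣ` which generate an ideal extended from `K`. -/
noncomputable def extendedGenerators : Subgroup Nˣ :=
  (extendIdeals K N).range.comap (toPrincipalIdeal (𝓞 N) N)

theorem comap_toPrincipalIdeal_map_principalIdeals :
    ((principalIdeals K).map (extendIdeals K N)).comap (toPrincipalIdeal (𝓞 N) N) =
      (unitsIn N).range ⊔ (Units.map (algebraMap K N).toMonoidHom).range := by
  ext α
  rw [Subgroup.mem_comap, Subgroup.mem_sup]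
  constructor
  · rintro ⟨_, ⟨x, rfl⟩, hx⟩
    rw [extendIdeals_toPrincipalIdeal, eq_comm, ← div_eq_one, ← map_div,
      toPrincipalIdeal_eq_one_iff] at hx
    obtain ⟨u, hu⟩ := hx
    exact ⟨_, ⟨u, rfl⟩, _, ⟨x, rfl⟩, by rw [← eq_div_iff_mul_eq']; exact Units.ext hu⟩
  · rintro ⟨_, ⟨u, rfl⟩, _, ⟨x, rfl⟩, rfl⟩
    refine ⟨_, ⟨x, rfl⟩, ?_⟩
    rw [extendIdeals_toPrincipalIdeal, map_mul,
      (toPrincipalIdeal_eq_one_iff (unitsIn N u)).mpr ⟨u, rfl⟩, one_mul]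

/-- The capitulation kernel, in terms of generators of the ideals of `K` that become principal. -/
theorem card_capitulationKernel_eq_relIndex_extendedGenerators :
    Nat.card (CapitulationKernel K N) =
      ((unitsIn N).range ⊔ (Units.map (algebraMap K N).toMonoidHom).range).relIndex
        (extendedGenerators K N) := by
  rw [card_capitulationKernel_eq_relIndex,
    ← Subgroup.relIndex_map_map_of_injective _ _ (extendIdeals_injective (E := K) (F := N)),
    Subgroup.map_comap_eq, ← comap_toPrincipalIdeal_map_principalIdeals, Subgroup.relIndex_comap,
    extendedGenerators, Subgroup.map_comap_eq, inf_comm]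

/-- The homomorphism `α ↦ g α / α` on `Nˣ`. -/
def quotHom (g : Gal(N/K)) : Nˣ →* Nˣ :=
  Units.map (g : N →* N) / MonoidHom.id Nˣ

omit [NumberField K] [NumberField N] in
variable {K N} in
theorem coe_quotHom (g : Gal(N/K)) (α : Nˣ) : (quotHom K N g α : N) = g α / α := by
  simp [quotHom]

variable [IsGalois K N] {g : Gal(N/K)} (hg : ∀ x, x ∈ Subgroup.zpowers g)

include hg in
theorem ker_quotHom :
    (quotHom K N g).ker = (Units.map (algebraMap K N).toMonoidHom).range := by
  ext α
  rw [MonoidHom.mem_ker, ← Units.val_inj, coe_quotHom, Units.val_one, div_eq_one_iff_eq α.ne_zero]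
  constructor
  · intro h
    have hall : ∀ s : Gal(N/K), s α = α := fun s => by
      have hle : Subgroup.zpowers g ≤ MulAction.stabilizer Gal(N/K) (α : N) :=
        Subgroup.zpowers_le.mpr h
      exact hle (hg s)
    obtain ⟨x, hx⟩ := (IsGalois.mem_range_algebraMap_iff_fixed (F := K) (α : N)).mpr hall
    have hx0 : x ≠ 0 := by rintro rfl; exact α.ne_zero (by rw [← hx, map_zero])
    exact ⟨Units.mk0 x hx0, Units.ext hx⟩
  · rintro ⟨x, rfl⟩
    exact g.commutes _

/-- The norm of units of `N`, as an endomorphism. -/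
noncomputable abbrev normUnits : (𝓞 N)ˣ →* (𝓞 N)ˣ :=
  (Units.map (algebraMap (𝓞 K) (𝓞 N)).toMonoidHom).comp (Units.map (RingOfIntegers.norm K))

include hg in
/-- By Hilbert's Theorem 90, the units of norm `1` are the units of the form `g α / α`, where
`(α)` is a Galois invariant ideal. -/
theorem map_extendedGenerators
    (hunr : ∀ P : Ideal (𝓞 N), ∀ _ : P.IsPrime, P ≠ ⊥ → Algebra.IsUnramifiedAt (𝓞 K) P) :
    (extendedGenerators K N).map (quotHom K N g) = (normUnits K N).ker.map (unitsIn N) := by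
  have hnorm : ∀ u : (𝓞 N)ˣ, u ∈ (normUnits K N).ker ↔ Algebra.norm K ((u : 𝓞 N) : N) = 1 := by
    intro u
    rw [MonoidHom.mem_ker, ← RingOfIntegers.coe_norm]
    constructor
    · intro h
      have h1 : algebraMap (𝓞 K) (𝓞 N) (RingOfIntegers.norm K (u : 𝓞 N)) = 1 :=
        congrArg Units.val h
      rw [← map_one (algebraMap (𝓞 K) (𝓞 N))] at h1
      rw [FaithfulSMul.algebraMap_injective _ _ h1]
      rfl
    · intro h
      ext1
      change algebraMap (𝓞 K) (𝓞 N) (RingOfIntegers.norm K (u : 𝓞 N)) = 1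
      have : RingOfIntegers.norm K (u : 𝓞 N) = 1 := NumberField.RingOfIntegers.ext h
      rw [this, map_one]
  ext β
  constructor
  · rintro ⟨α, hα, rfl⟩
    obtain ⟨u, hu⟩ := exists_unit_of_toPrincipalIdeal_mem_range hα g
    have hu' : (u : N) = g α / α := by rw [hu, mul_div_cancel_right₀ _ α.ne_zero]
    refine ⟨u, (hnorm u).mpr ?_, Units.ext ((coe_quotHom g α).trans hu'.symm).symm⟩
    change Algebra.norm K (algebraMap (𝓞 N) N u) = 1
    rw [hu', div_eq_mul_inv, map_mul, Algebra.norm_eq_of_algEquiv g, ← map_mul,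
      mul_inv_cancel₀ α.ne_zero, map_one]
  · rintro ⟨u, hu, rfl⟩
    obtain ⟨α, hα'⟩ := exists_eq_mul_of_norm_eq_one hg ((hnorm u).mp hu)
    refine ⟨α, ?_, Units.ext ?_⟩
    · refine toPrincipalIdeal_mem_range hunr fun s => ?_
      obtain ⟨k, rfl⟩ := mem_powers_iff_mem_zpowers.mpr (hg s)
      simp only
      induction k with
      | zero => exact ⟨1, by simp⟩
      | succ k ih =>
        obtain ⟨v, hv⟩ := ih
        refine ⟨Units.map (MulSemiringAction.toRingHom Gal(N/K) (𝓞 N) g).toMonoidHom v * u, ?_⟩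
        rw [pow_succ', AlgEquiv.mul_apply, hv, map_mul, hα', Units.val_mul, map_mul, mul_assoc]
        rfl
    · rw [coe_quotHom, hα', mul_div_cancel_right₀ _ α.ne_zero]
      rfl

end Capitulation

/-! ### The Herbrand quotient of the units -/

section UnitHerbrand

variable (K N : Type*) [Field K] [NumberField K] [Field N] [NumberField N] [Algebra K N]

/-- The action of a Galois automorphism on units. -/
noncomputable abbrev unitAut (g : Gal(N/K)) : (𝓞 N)ˣ →* (𝓞 N)ˣ :=
  Units.map (MulSemiringAction.toRingHom Gal(N/K) (𝓞 N) g).toMonoidHom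

omit [NumberField K] in
variable {K N} in
theorem unitsIn_unitAut (g : Gal(N/K)) (u : (𝓞 N)ˣ) :
    (unitsIn N (unitAut K N g u) : N) = g (unitsIn N u : N) := rfl

theorem unitsIn_injective (F : Type*) [Field F] [NumberField F] :
    Function.Injective (unitsIn F) :=
  Units.map_injective (FaithfulSMul.algebraMap_injective (𝓞 F) F)

variable [IsGalois K N] {g : Gal(N/K)} (hg : ∀ x, x ∈ Subgroup.zpowers g)

include hg in
/-- Applying `α ↦ g α / α` to the generators of extended ideals turns the capitulation kernel into
the units of norm one modulo the units of the form `g u / u`. -/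
theorem card_capitulationKernel_eq_relIndex_units
    (hunr : ∀ P : Ideal (𝓞 N), ∀ _ : P.IsPrime, P ≠ ⊥ → Algebra.IsUnramifiedAt (𝓞 K) P) :
    Nat.card (CapitulationKernel K N) =
      (unitAut K N g / MonoidHom.id _).range.relIndex (normUnits K N).ker := by
  have hle : (quotHom K N g).ker ≤ extendedGenerators K N := by
    rw [ker_quotHom K N hg]
    rintro _ ⟨x, rfl⟩
    exact ⟨_, extendIdeals_toPrincipalIdeal x⟩
  have h1 : (unitsIn N).range.map (quotHom K N g) =
      (unitAut K N g / MonoidHom.id _).range.map (unitsIn N) := by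
    ext β
    constructor
    · rintro ⟨_, ⟨u, rfl⟩, rfl⟩
      refine ⟨_, ⟨u, rfl⟩, Units.ext ?_⟩
      rw [coe_quotHom, MonoidHom.div_apply, map_div, Units.val_div_eq_div_val, unitsIn_unitAut]
      rfl
    · rintro ⟨_, ⟨u, rfl⟩, rfl⟩
      refine ⟨_, ⟨u, rfl⟩, Units.ext ?_⟩
      rw [coe_quotHom, MonoidHom.div_apply, map_div, Units.val_div_eq_div_val, unitsIn_unitAut]
      rfl
  rw [card_capitulationKernel_eq_relIndex_extendedGenerators, ← ker_quotHom K N hg,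
    ← Subgroup.relIndex_map_map_of_injective _ _ (unitsIn_injective N), ← h1,
    ← map_extendedGenerators K N hg hunr, Subgroup.relIndex_map_map, sup_eq_left.mpr hle]

omit [NumberField K] [NumberField N] [IsGalois K N] in
theorem algebraMap_units_injective :
    Function.Injective (Units.map (algebraMap (𝓞 K) (𝓞 N)).toMonoidHom) :=
  Units.map_injective (FaithfulSMul.algebraMap_injective (𝓞 K) (𝓞 N))

include hg in
theorem ker_unitAut_div_id :
    (unitAut K N g / MonoidHom.id _).ker =
      (Units.map (algebraMap (𝓞 K) (𝓞 N)).toMonoidHom).range := by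
  ext u
  rw [MonoidHom.mem_ker, MonoidHom.div_apply, div_eq_one]
  constructor
  · intro h
    have hall : ∀ s : Gal(N/K), s • (u : 𝓞 N) = u := fun s => by
      have hle : Subgroup.zpowers g ≤ MulAction.stabilizer Gal(N/K) (u : 𝓞 N) :=
        Subgroup.zpowers_le.mpr (congrArg Units.val h)
      exact hle (hg s)
    have hall' : ∀ s : Gal(N/K), s • ((u⁻¹ : (𝓞 N)ˣ) : 𝓞 N) = (u⁻¹ : (𝓞 N)ˣ) := fun s => by
      have h1 : s • ((u : 𝓞 N) * ((u⁻¹ : (𝓞 N)ˣ) : 𝓞 N)) = 1 := by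
        rw [Units.mul_inv, smul_one]
      rw [smul_mul', hall] at h1
      exact eq_comm.mp (Units.inv_eq_of_mul_eq_one_right h1)
    obtain ⟨x, hx⟩ := Algebra.IsInvariant.isInvariant (A := 𝓞 K) (G := Gal(N/K)) _ hall
    obtain ⟨y, hy⟩ := Algebra.IsInvariant.isInvariant (A := 𝓞 K) (G := Gal(N/K)) _ hall'
    have hxy : x * y = 1 := FaithfulSMul.algebraMap_injective (𝓞 K) (𝓞 N) (by
      rw [map_mul, hx, hy, Units.mul_inv, map_one])
    exact ⟨⟨x, y, hxy, by rw [mul_comm, hxy]⟩, Units.ext hx⟩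
  · rintro ⟨x, rfl⟩
    ext
    exact g.commutes _

omit [NumberField K] [NumberField N] [IsGalois K N] in
theorem card_unitNormIndex_eq_relIndex :
    Nat.card (UnitNormIndex K N) = (normUnits K N).range.relIndex
      (Units.map (algebraMap (𝓞 K) (𝓞 N)).toMonoidHom).range := by
  rw [MonoidHom.range_comp, MonoidHom.range_eq_map (Units.map (algebraMap (𝓞 K) (𝓞 N)).toMonoidHom),
    Subgroup.relIndex_map_map_of_injective _ _ (algebraMap_units_injective K N),
    Subgroup.relIndex_top_right, Subgroup.index_eq_card]

include hg in
theorem normUnits_eq_prod (u : (𝓞 N)ˣ) :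
    normUnits K N u = ∏ i ∈ Finset.range (Fintype.card Gal(N/K)), unitAut K N (g ^ i) u := by
  apply unitsIn_injective N
  refine Units.ext ?_
  have h1 : ((unitsIn N (normUnits K N u) : Nˣ) : N) =
      algebraMap K N (Algebra.norm K ((u : 𝓞 N) : N)) := rfl
  rw [h1, Algebra.norm_eq_prod_automorphisms, prod_eq_prod_range_pow hg, map_prod, Units.coe_prod]
  rfl

include hg in
/-- The Herbrand quotient of the units: in a cyclic extension `N/K` of odd prime degree `p` that is
unramified at all finite primes, the capitulation kernel has `p` times as many elements as the
group of units of `K` modulo norms of units. -/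
theorem card_capitulationKernel {p : ℕ} (hp : p.Prime) (hp2 : p ≠ 2)
    (hdeg : Module.finrank K N = p)
    (hunr : ∀ P : Ideal (𝓞 N), ∀ _ : P.IsPrime, P ≠ ⊥ → Algebra.IsUnramifiedAt (𝓞 K) P) :
    Nat.card (CapitulationKernel K N) = p * Nat.card (UnitNormIndex K N) := by
  have hcardG : Fintype.card Gal(N/K) = p := by
    rw [← Nat.card_eq_fintype_card, IsGalois.card_aut_eq_finrank, hdeg]
  have hgp : g ^ p = 1 := by rw [← hcardG, pow_card_eq_one]
  let s : Module.End ℤ (Additive (𝓞 N)ˣ) := (unitAut K N g).toAdditive.toIntLinearMap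
  let n : Module.End ℤ (Additive (𝓞 N)ˣ) := (normUnits K N).toAdditive.toIntLinearMap
  have hspow : ∀ (i : ℕ) (u : (𝓞 N)ˣ), (s ^ i) (Additive.ofMul u) =
      Additive.ofMul (unitAut K N (g ^ i) u) := fun i u => by
    induction i with
    | zero =>
      rw [pow_zero, pow_zero, Module.End.one_apply]
      exact congrArg Additive.ofMul (Units.ext (one_smul Gal(N/K) (u : 𝓞 N)).symm)
    | succ i ih =>
      rw [pow_succ', Module.End.mul_apply, ih, pow_succ']
      rfl
  have hsp : s ^ p = 1 := by
    refine LinearMap.ext fun u => ?_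
    obtain ⟨u, rfl⟩ := Additive.ofMul.surjective u
    rw [hspow, hgp]
    congr 1
  have hn : n = ∑ i ∈ Finset.range p, s ^ i := by
    refine LinearMap.ext fun u => ?_
    obtain ⟨u, rfl⟩ := Additive.ofMul.surjective u
    rw [LinearMap.sum_apply, Finset.sum_congr rfl fun i _ => hspow i u, ← ofMul_prod]
    exact congrArg Additive.ofMul (hcardG ▸ normUnits_eq_prod K N hg u)
  have hunits : (s - 1).toAddMonoidHom.ker =
      ((Units.map (algebraMap (𝓞 K) (𝓞 N)).toMonoidHom).range).toAddSubgroup := by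
    rw [← ker_unitAut_div_id K N hg]
    rfl
  have hrankK : Module.finrank ℤ (LinearMap.ker (s - 1)) = NumberField.Units.rank K := by
    let j : Additive (𝓞 K)ˣ →ₗ[ℤ] Additive (𝓞 N)ˣ :=
      (Units.map (algebraMap (𝓞 K) (𝓞 N)).toMonoidHom).toAdditive.toIntLinearMap
    have h1 : LinearMap.ker (s - 1) = LinearMap.range j := by
      ext x
      have := SetLike.ext_iff.mp hunits x
      exact this
    have h2 : Function.Injective j := algebraMap_units_injective K N
    rw [h1, LinearMap.finrank_range_of_inj h2, NumberField.Units.finrank_eq]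
  -- as `p` is odd, no infinite place ramifies, and `N` has `p` times as many of them as `K`
  have hrank : Module.finrank ℤ (Additive (𝓞 N)ˣ) + 1 =
      p * (Module.finrank ℤ (LinearMap.ker (s - 1)) + 1) := by
    have hodd : Odd (Module.finrank K N) := hdeg ▸ hp.odd_of_ne_two hp2
    have := IsUnramifiedAtInfinitePlaces_of_odd_finrank hodd
    have h1 := IsUnramifiedAtInfinitePlaces.card_infinitePlace K N
    have h2 : 0 < Fintype.card (NumberField.InfinitePlace N) := Fintype.card_pos
    have h3 : 0 < Fintype.card (NumberField.InfinitePlace K) := Fintype.card_pos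
    rw [hrankK, NumberField.Units.finrank_eq, NumberField.Units.rank, NumberField.Units.rank,
      Nat.sub_add_cancel h2, Nat.sub_add_cancel h3, h1, hdeg, mul_comm]
  have h := relIndex_range_sub_one_eq hp s hsp n hn hrank
  rw [card_capitulationKernel_eq_relIndex_units K N hg hunr, card_unitNormIndex_eq_relIndex,
    ← Subgroup.relIndex_toAddSubgroup, ← Subgroup.relIndex_toAddSubgroup, ← hunits]
  exact h

end UnitHerbrand

/-! ### Inertia groups -/

section Inertia

open Pointwise

/-- The inertia group of an unramified prime is trivial. -/
theorem inertia_eq_bot (K N : Type*) [Field K] [NumberField K] [Field N] [NumberField N]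
    [Algebra K N] [IsGalois K N] (P : Ideal (𝓞 N)) [P.IsMaximal]
    (hP : Algebra.IsUnramifiedAt (𝓞 K) P) : P.inertia Gal(N/K) = ⊥ := by
  have h1 := Ideal.card_inertia_eq_ramificationIdxIn (G := Gal(N/K)) (P.under (𝓞 K)) P
  rw [Ideal.ramificationIdxIn_eq_ramificationIdx (P.under (𝓞 K)) P Gal(N/K),
    Ideal.ramificationIdx_eq_one] at h1
  exact Subgroup.card_eq_one.mp h1

/-- By Minkowski's theorem, the Galois group of a number field is generated by inertia groups. -/
theorem iSup_inertia_eq_top (M : Type*) [Field M] [NumberField M] [IsGalois ℚ M] :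
    ⨆ P : MaximalSpectrum (𝓞 M), P.asIdeal.inertia Gal(M/ℚ) = ⊤ := by
  obtain ⟨S, hS⟩ : ∃ S, S = ⨆ P : MaximalSpectrum (𝓞 M), P.asIdeal.inertia Gal(M/ℚ) := ⟨_, rfl⟩
  rw [← hS]
  -- the fixed field `F` of all inertia groups is unramified over `ℚ`
  let F : IntermediateField ℚ M := FixedPoints.intermediateField S
  have hG : IsGaloisGroup S F M := IsGaloisGroup.subgroup Gal(M/ℚ) ℚ M S
  have hsmul : ∀ (g : S) (x : 𝓞 M), ((g • x : 𝓞 M) : M) = g • (x : M) := fun g x => rfl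
  have : SMulDistribClass S (𝓞 M) M := ⟨fun g x y => by
    rw [Algebra.smul_def, Algebra.smul_def, smul_mul']; rfl⟩
  have hG' : IsGaloisGroup S (𝓞 F) (𝓞 M) := IsGaloisGroup.of_isFractionRing S (𝓞 F) (𝓞 M) F M
  by_cases hF : Module.finrank ℚ F = 1
  · refine Subgroup.eq_top_of_card_eq _ ?_
    rw [← IsGaloisGroup.finrank_fixedPoints_eq_card_subgroup Gal(M/ℚ) ℚ M S,
      IsGaloisGroup.card_eq_finrank Gal(M/ℚ) ℚ M, ← Module.finrank_mul_finrank ℚ F M, hF, one_mul]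
  obtain ⟨Q, hQ, hram⟩ := NumberField.exists_not_isUnramifiedAt_int (𝒪 := 𝓞 F) hF
  obtain ⟨P, hP, hPQ⟩ := Ideal.exists_maximal_ideal_liesOver_of_isIntegral (S := 𝓞 M) Q
  refine absurd (Ideal.ramificationIdx_eq_one_iff.mp ?_) hram
  have h1 := Ideal.card_inertia_eq_ramificationIdxIn (G := Gal(M/ℚ)) (P.under ℤ) P
  rw [Ideal.ramificationIdxIn_eq_ramificationIdx (P.under ℤ) P Gal(M/ℚ)] at h1
  have h2 := Ideal.card_inertia_eq_ramificationIdxIn (G := S) Q P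
  rw [Ideal.ramificationIdxIn_eq_ramificationIdx Q P S] at h2
  -- `P` has the same inertia group over `F` as over `ℚ`
  have h3 : Nat.card (P.inertia S) = Nat.card (P.inertia Gal(M/ℚ)) := by
    refine Nat.card_congr ⟨fun s => ⟨s.1.1, s.2⟩, fun s => ⟨⟨s.1, ?_⟩, s.2⟩, fun _ => rfl,
      fun _ => rfl⟩
    rw [hS]
    exact Subgroup.mem_iSup_of_mem ⟨P, hP⟩ s.2
  have h4 := Ideal.ramificationIdx_tower (R := ℤ) (q := Q) (r := P)
  rw [← h1, ← h2, h3] at h4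
  exact mul_right_cancel₀ (Nat.card_pos (α := P.inertia Gal(M/ℚ))).ne' (h4.symm.trans
    (one_mul _).symm)

/-- A group with an abelian subgroup `H` of index two which is generated by involutions outside `H`
contains an involution that inverts `H`. -/
theorem exists_involution_inverting {G : Type*} [Group G] {H : Subgroup G} (hH : H.index = 2)
    (hcomm : ∀ a ∈ H, ∀ b ∈ H, a * b = b * a) {T : Set G} (hT : Subgroup.closure T = ⊤)
    (hT2 : ∀ s ∈ T, s * s = 1) (hTH : ∀ s ∈ T, s ∈ H → s = 1) :
    ∃ t, t ∉ H ∧ t * t = 1 ∧ ∀ h ∈ H, t * h * t = h⁻¹ := by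
  obtain ⟨t, htT, htH⟩ : ∃ t ∈ T, t ∉ H := by
    by_contra! h
    have : H = ⊤ := top_le_iff.mp (hT ▸ (Subgroup.closure_le H).mpr h)
    simp [this] at hH
  have ht2 := hT2 t htT
  have htinv : t⁻¹ = t := inv_eq_of_mul_eq_one_right ht2
  have htt : ∀ g, t * (t * g) = g := fun g => by rw [← mul_assoc, ht2, one_mul]
  let D : Subgroup G :=
    { carrier := {h | h ∈ H ∧ t * h * t = h⁻¹}
      mul_mem' := fun {a b} ha hb => ⟨H.mul_mem ha.1 hb.1, by
        have e : t * (a * b) * t = (t * a * t) * (t * b * t) := by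
          simp only [mul_assoc, htt]
        rw [e, ha.2, hb.2, ← mul_inv_rev, hcomm _ hb.1 _ ha.1]⟩
      one_mem' := ⟨H.one_mem, by simp [ht2]⟩
      inv_mem' := fun {a} ha => ⟨H.inv_mem ha.1, by
        simpa [mul_assoc, htinv] using congrArg (·⁻¹) ha.2⟩ }
  have hDt : ∀ d ∈ D, d * t = t * d⁻¹ := fun d hd => by
    rw [← hd.2, mul_assoc, htt]
  have hinv : ∀ x, t * x ∈ D → x⁻¹ = x := fun x hx => by
    have := hDt _ hx
    rw [mul_inv_rev, htinv, mul_assoc] at this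
    exact (mul_right_cancel (mul_left_cancel this)).symm
  -- the union of `D` and `t * D` is a subgroup containing the generators
  have key : ∀ g : G, g ∈ D ∨ t * g ∈ D := fun g => by
    have hg : g ∈ Subgroup.closure T := hT ▸ Subgroup.mem_top g
    induction hg using Subgroup.closure_induction with
    | mem s hs =>
      by_cases hsH : s ∈ H
      · exact Or.inl (hTH s hs hsH ▸ D.one_mem)
      · refine Or.inr ⟨(Subgroup.mul_mem_iff_of_index_two hH).mpr (by tauto), ?_⟩
        rw [htt, mul_inv_rev, htinv, inv_eq_of_mul_eq_one_right (hT2 s hs)]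
    | one => exact Or.inl D.one_mem
    | mul x y _ _ hx hy =>
      rcases hx with hx | hx <;> rcases hy with hy | hy
      · exact Or.inl (D.mul_mem hx hy)
      · refine Or.inr ?_
        have : t * (x * y) = x⁻¹ * (t * y) := by
          rw [← htt (x * y), ← htt y, ← mul_assoc x t, hDt x hx]; simp only [mul_assoc, htt]
        exact this ▸ D.mul_mem (D.inv_mem hx) hy
      · exact Or.inr (by rw [← mul_assoc]; exact D.mul_mem hx hy)
      · refine Or.inl ?_
        have : x * y = (t * x)⁻¹ * (t * y) := by
          rw [mul_inv_rev, htinv, mul_assoc, htt, hinv x hx]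
        exact this ▸ D.mul_mem (D.inv_mem hx) hy
    | inv x _ hx =>
      refine hx.imp (fun hx => D.inv_mem hx) fun hx => ?_
      rwa [hinv x hx]
  refine ⟨t, htH, ht2, fun h hh => ?_⟩
  have hth : t * h ∉ H := fun hmem => htH ((H.mul_mem_cancel_right hh).mp hmem)
  exact ((key h).resolve_right fun hd => hth hd.1).2

end Inertia

/-! ### The dihedral Galois group -/

section Dihedral

open Pointwise

variable (K N M : Type*) [Field K] [NumberField K] [Field N] [NumberField N] [Algebra K N]
  [Field M] [NumberField M] [Algebra K M] [Algebra N M] [IsScalarTower K N M]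

/-- The subgroup `Gal(M/K)` of `Gal(M/ℚ)`. -/
noncomputable def galSubgroup : Subgroup Gal(M/ℚ) :=
  (AlgEquiv.restrictScalarsHom ℚ : Gal(M/K) →* Gal(M/ℚ)).range

theorem mem_galSubgroup (σ : Gal(M/ℚ)) :
    σ ∈ galSubgroup K M ↔ ∀ x : K, σ (algebraMap K M x) = algebraMap K M x := by
  constructor
  · rintro ⟨σ, rfl⟩ x
    exact σ.commutes x
  · intro h
    exact ⟨AlgEquiv.ofRingEquiv (f := σ.toRingEquiv) h, AlgEquiv.ext fun _ => rfl⟩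

theorem index_galSubgroup [IsGalois ℚ M] : (galSubgroup K M).index = Module.finrank ℚ K := by
  have : IsGalois K M := IsGalois.tower_top_of_isGalois ℚ K M
  have hinj : Function.Injective (AlgEquiv.restrictScalarsHom ℚ : Gal(M/K) →* Gal(M/ℚ)) :=
    AlgEquiv.restrictScalars_injective ℚ
  have h1 := (galSubgroup K M).card_mul_index
  have h2 : Nat.card (galSubgroup K M) = Nat.card Gal(M/K) :=
    Nat.card_congr (MonoidHom.ofInjective hinj).symm.toEquiv
  rw [h2, IsGalois.card_aut_eq_finrank, IsGalois.card_aut_eq_finrank,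
    ← Module.finrank_mul_finrank ℚ K M, mul_comm] at h1
  exact mul_right_cancel₀ Module.finrank_pos.ne' h1

/-- An element of an inertia group of `M/K` acts trivially on an extension of `K` in which the
prime is unramified. -/
theorem apply_algebraMap_of_mem_inertia [IsGalois K N]
    (hunr : ∀ P : Ideal (𝓞 N), ∀ _ : P.IsPrime, P ≠ ⊥ → Algebra.IsUnramifiedAt (𝓞 K) P)
    (P : Ideal (𝓞 M)) [P.IsMaximal] (σ : Gal(M/ℚ)) (hσ : σ ∈ P.inertia Gal(M/ℚ))
    (hσK : σ ∈ galSubgroup K M) (y : N) : σ (algebraMap N M y) = algebraMap N M y := by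
  obtain ⟨σ, rfl⟩ := hσK
  have : (P.under (𝓞 N)).IsMaximal := Ideal.IsMaximal.under _ P
  have hne : P.under (𝓞 N) ≠ ⊥ := Ideal.IsMaximal.ne_bot_of_isIntegral_int _
  have h1 := inertia_eq_bot K N (P.under (𝓞 N)) (hunr _ inferInstance hne)
  have h2 : σ.restrictNormal N ∈ (P.under (𝓞 N)).inertia Gal(N/K) := by
    intro x
    have := hσ (algebraMap (𝓞 N) (𝓞 M) x)
    change algebraMap (𝓞 N) (𝓞 M) _ ∈ P
    rw [map_sub]
    convert this using 1
    change _ ∈ P ↔ _ ∈ P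
    convert Iff.rfl using 3
    ext
    exact (AlgEquiv.restrictNormal_commutes σ N (x : N)).symm
  rw [h1, Subgroup.mem_bot] at h2
  have := AlgEquiv.restrictNormal_commutes σ N y
  rw [h2] at this
  exact this.symm

omit [NumberField N] in
/-- The hypothesis `hcore`, which recurs below, says that `M` is generated by the conjugates of `N`.
Commutators in `Gal(M/K)` fix all of them. -/
theorem galSubgroup_comm [IsGalois K N] [IsGalois ℚ M] (hK : Module.finrank ℚ K = 2)
    (hcomm : ∀ a b : Gal(N/K), a * b = b * a)
    (hcore : ∀ σ : Gal(M/ℚ), (∀ g : Gal(M/ℚ), ∀ y : N,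
      (g⁻¹ * σ * g) (algebraMap N M y) = algebraMap N M y) → σ = 1) :
    ∀ a ∈ galSubgroup K M, ∀ b ∈ galSubgroup K M, a * b = b * a := by
  have hn : (galSubgroup K M).Normal :=
    Subgroup.normal_of_index_eq_two ((index_galSubgroup K M).trans hK)
  intro a ha b hb
  rw [← mul_inv_eq_one]
  refine hcore _ fun g y => ?_
  obtain ⟨a', ha'⟩ := hn.conj_mem' a ha g
  obtain ⟨b', hb'⟩ := hn.conj_mem' b hb g
  have e : g⁻¹ * (a * b * (b * a)⁻¹) * g =
      (g⁻¹ * a * g) * (g⁻¹ * b * g) * ((g⁻¹ * b * g) * (g⁻¹ * a * g))⁻¹ := by group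
  rw [e, ← ha', ← hb', ← map_mul, ← map_mul, ← map_inv, ← map_mul]
  have := AlgEquiv.restrictNormal_commutes (a' * b' * (b' * a')⁻¹) N y
  have h1 : (a' * b' * (b' * a')⁻¹).restrictNormal N = 1 := by
    change AlgEquiv.restrictNormalHom N _ = 1
    rw [map_mul, map_inv, map_mul, map_mul, mul_inv_eq_one]
    exact hcomm _ _
  rw [h1] at this
  exact this.symm

/-- Inertia elements in `Gal(M/K)` fix all conjugates of `N`, which are unramified over `K`, so they
are trivial. As inertia groups generate `Gal(M/ℚ)`, some involution inverts `Gal(M/K)`. -/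
theorem exists_involution_of_core [IsGalois K N] [IsGalois ℚ M] (hK : Module.finrank ℚ K = 2)
    (hcomm : ∀ a b : Gal(N/K), a * b = b * a)
    (hunr : ∀ P : Ideal (𝓞 N), ∀ _ : P.IsPrime, P ≠ ⊥ → Algebra.IsUnramifiedAt (𝓞 K) P)
    (hcore : ∀ σ : Gal(M/ℚ), (∀ g : Gal(M/ℚ), ∀ y : N,
      (g⁻¹ * σ * g) (algebraMap N M y) = algebraMap N M y) → σ = 1) :
    ∃ t, t ∉ galSubgroup K M ∧ t * t = 1 ∧ ∀ h ∈ galSubgroup K M, t * h * t = h⁻¹ := by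
  have hindex := (index_galSubgroup K M).trans hK
  have hn : (galSubgroup K M).Normal := Subgroup.normal_of_index_eq_two hindex
  have hTH : ∀ (P : MaximalSpectrum (𝓞 M)), ∀ s ∈ P.asIdeal.inertia Gal(M/ℚ),
      s ∈ galSubgroup K M → s = 1 := by
    intro P s hs hsK
    refine hcore s fun g y => ?_
    have := P.2
    have hmax : (g⁻¹ • P.asIdeal).IsMaximal := by
      have := this.isPrime
      refine Ideal.IsPrime.isMaximal inferInstance fun h => ?_
      refine Ideal.IsMaximal.ne_bot_of_isIntegral_int P.asIdeal ?_
      rw [← smul_inv_smul g P.asIdeal, h]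
      exact Ideal.map_bot
    refine apply_algebraMap_of_mem_inertia K N M hunr (g⁻¹ • P.asIdeal) _ (fun x => ?_)
      (hn.conj_mem' s hsK g) y
    rw [Submodule.mem_toAddSubgroup, Ideal.mem_inv_pointwise_smul_iff, smul_sub]
    have := hs (g • x)
    rwa [smul_smul, mul_assoc, mul_inv_cancel_left, ← smul_smul]
  refine exists_involution_inverting hindex (galSubgroup_comm K N M hK hcomm hcore)
    (T := ⋃ P : MaximalSpectrum (𝓞 M), (P.asIdeal.inertia Gal(M/ℚ) : Set Gal(M/ℚ))) ?_ ?_ ?_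
  · rw [Subgroup.closure_iUnion]
    simpa using iSup_inertia_eq_top M
  · intro s hs
    obtain ⟨P, hP⟩ := Set.mem_iUnion.mp hs
    exact hTH P _ (mul_mem hP hP) (Subgroup.mul_self_mem_of_index_two hindex s)
  · intro s hs
    obtain ⟨P, hP⟩ := Set.mem_iUnion.mp hs
    exact hTH P s hP

/-- An automorphism of the normal closure of `N` whose conjugates all fix `N` is trivial. -/
theorem eq_one_of_forall_conj_fixes [IsGalois ℚ M] [IsNormalClosure ℚ N M] (σ : Gal(M/ℚ))
    (hσ : ∀ g : Gal(M/ℚ), ∀ y : N,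
      (g⁻¹ * σ * g) (algebraMap N M y) = algebraMap N M y) : σ = 1 := by
  have h : (⊤ : IntermediateField ℚ M) ≤
      FixedPoints.intermediateField (Subgroup.zpowers σ) := by
    rw [← IsNormalClosure.adjoin_rootSet (F := ℚ) (K := N) (L := M), iSup_le_iff]
    intro x
    rw [IntermediateField.adjoin_le_iff]
    intro r hr
    have hroot : Polynomial.aeval r (minpoly ℚ (algebraMap N M x)) = 0 := by
      rw [minpoly.algebraMap_eq (algebraMap N M).injective]
      exact (Polynomial.mem_rootSet.mp hr).2
    obtain ⟨g, rfl⟩ := minpoly.exists_algEquiv_of_root' (Algebra.IsAlgebraic.isAlgebraic _) hroot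
    have hfix : σ ∈ MulAction.stabilizer Gal(M/ℚ) (g (algebraMap N M x)) := by
      have := congrArg g (hσ g x)
      rw [AlgEquiv.mul_apply, AlgEquiv.mul_apply, ← AlgEquiv.mul_apply g, mul_inv_cancel] at this
      exact this
    rintro ⟨τ, hτ⟩
    exact (Subgroup.zpowers_le.mpr hfix) hτ
  exact AlgEquiv.ext fun x => h (IntermediateField.mem_top (x := x))
    ⟨σ, Subgroup.mem_zpowers σ⟩

/-- An unramified abelian extension of a quadratic field is Galois over `ℚ`: in the Galois group of
its normal closure `M`, conjugation fixes or inverts the elements of `Gal(M/K)`, so that `Gal(M/N)`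
is normal. -/
theorem isGalois_rat_of_isUnramified [IsGalois K N] (hK : Module.finrank ℚ K = 2)
    (hcomm : ∀ a b : Gal(N/K), a * b = b * a)
    (hunr : ∀ P : Ideal (𝓞 N), ∀ _ : P.IsPrime, P ≠ ⊥ → Algebra.IsUnramifiedAt (𝓞 K) P) :
    IsGalois ℚ N := by
  have : Algebra.IsAlgebraic ℚ (AlgebraicClosure N) :=
    Algebra.IsAlgebraic.trans ℚ N (AlgebraicClosure N)
  have : IsAlgClosure ℚ (AlgebraicClosure N) := ⟨inferInstance, inferInstance⟩
  have : Normal ℚ (AlgebraicClosure N) := IsAlgClosure.normal ℚ (AlgebraicClosure N)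
  let M := IntermediateField.normalClosure ℚ N (AlgebraicClosure N)
  have : NumberField M := { to_charZero := inferInstance, to_finiteDimensional := inferInstance }
  have : IsNormalClosure ℚ N M := by
    have : Nonempty (N →ₐ[ℚ] AlgebraicClosure N) := ⟨IsScalarTower.toAlgHom ℚ N _⟩
    convert! isNormalClosure_normalClosure (F := ℚ) (K := N) (L := AlgebraicClosure N)
  have : Normal ℚ M := IsNormalClosure.normal (K := N)
  have : IsGalois ℚ M := ⟨⟩
  let : Algebra K M := ((algebraMap N M).comp (algebraMap K N)).toAlgebra
  have : IsScalarTower K N M := IsScalarTower.of_algebraMap_eq fun _ => rfl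
  have hcore := eq_one_of_forall_conj_fixes N M
  obtain ⟨t, htH, ht2, hinv⟩ := exists_involution_of_core K N M hK hcomm hunr hcore
  have hH := galSubgroup_comm K N M hK hcomm hcore
  have hindex := (index_galSubgroup K M).trans hK
  have : IsGalois N M := IsGalois.tower_top_of_isGalois ℚ N M
  -- `Gal(M/N)` is normal, and `M` is the normal closure of `N`
  have htriv : ∀ σ : Gal(M/N), σ = 1 := fun σ => by
    have hσH : σ.restrictScalars ℚ ∈ galSubgroup K M := (mem_galSubgroup K M _).mpr fun x =>
      σ.commutes (algebraMap K N x)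
    refine AlgEquiv.restrictScalars_injective ℚ (hcore _ fun g y => ?_)
    by_cases hg : g ∈ galSubgroup K M
    · rw [mul_assoc, hH _ hσH _ hg, inv_mul_cancel_left]
      exact σ.commutes y
    · have htg : t * g ∈ galSubgroup K M := by
        rw [Subgroup.mul_mem_iff_of_index_two hindex]; tauto
      obtain ⟨s, hs⟩ : ∃ s, s = σ.restrictScalars ℚ := ⟨_, rfl⟩
      rw [← hs] at hσH ⊢
      have e : g⁻¹ * s * g = (t * g)⁻¹ * (t * s * t) * (t * g) := by
        have : t * s * t * (t * g) = t * (s * g) := by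
          rw [mul_assoc _ t, ← mul_assoc t t, ht2, one_mul, mul_assoc]
        rw [mul_assoc, mul_assoc, this, mul_inv_rev, mul_assoc, inv_mul_cancel_left]
      rw [e, hinv s hσH, mul_assoc, hH _ (inv_mem hσH) _ htg, inv_mul_cancel_left, hs]
      exact σ.symm.commutes y
  have hfin : Module.finrank N M = 1 := by
    rw [← IsGalois.card_aut_eq_finrank, Nat.card_eq_one_iff_exists]
    exact ⟨1, htriv⟩
  have hbij := Algebra.finrank_eq_one_iff_bijective_algebraMap.mp hfin
  exact IsGalois.of_algEquiv
    (AlgEquiv.ofBijective (IsScalarTower.toAlgHom ℚ N M) hbij).symm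

/-- The Galois group of an unramified extension of odd prime degree of a quadratic field is a
dihedral group. -/
theorem nonempty_mulEquiv_dihedralGroup [IsGalois K N] [IsGalois ℚ N]
    (hK : Module.finrank ℚ K = 2) {p : ℕ} (hp : p.Prime) (hdeg : Module.finrank K N = p)
    (hunr : ∀ P : Ideal (𝓞 N), ∀ _ : P.IsPrime, P ≠ ⊥ → Algebra.IsUnramifiedAt (𝓞 K) P) :
    Nonempty (Gal(N/ℚ) ≃* DihedralGroup p) := by
  have hcard : Nat.card Gal(N/K) = p := by rw [IsGalois.card_aut_eq_finrank, hdeg]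
  have := Fact.mk hp
  have hcyc : IsCyclic Gal(N/K) := isCyclic_of_prime_card hcard
  have : NeZero p := ⟨hp.ne_zero⟩
  obtain ⟨t, htH, ht2, hinv⟩ := exists_involution_of_core K N N hK
    (fun a b => hcyc.commGroup.mul_comm a b) hunr fun σ h => AlgEquiv.ext fun y => by
      simpa using h 1 y
  have hrr : Function.Injective (AlgEquiv.restrictScalarsHom ℚ : Gal(N/K) →* Gal(N/ℚ)) :=
    AlgEquiv.restrictScalars_injective ℚ
  obtain ⟨e, he, heH⟩ : ∃ e : Multiplicative (ZMod p) →* Gal(N/ℚ), Function.Injective e ∧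
      ∀ i, e i ∈ galSubgroup K N := by
    subst hcard
    exact ⟨(AlgEquiv.restrictScalarsHom ℚ).comp (zmodCyclicMulEquiv hcyc).toMonoidHom,
      hrr.comp (zmodCyclicMulEquiv hcyc).injective, fun i => ⟨_, rfl⟩⟩
  have het : ∀ i, e i * t = t * (e i)⁻¹ := fun i => by
    rw [← hinv _ (heH i), mul_assoc, ← mul_assoc t t, ht2, one_mul]
  -- in Mathlib's convention `sr i = s * r i`, so the reflection `s` is sent to `t`
  let φ : DihedralGroup p →* Gal(N/ℚ) :=
    { toFun := fun x => match x with
        | .r i => e (.ofAdd i)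
        | .sr i => t * e (.ofAdd i)
      map_one' := e.map_one
      map_mul' := fun x y => by
        rcases x with i | i <;> rcases y with j | j
        · exact e.map_mul _ _
        · change t * e (.ofAdd (j - i)) = e _ * (t * e _)
          rw [← mul_assoc, het, mul_assoc, ← map_inv, ← map_mul, ← ofAdd_neg, ← ofAdd_add,
            neg_add_eq_sub]
        · change t * e (.ofAdd (i + j)) = t * e _ * e _
          rw [mul_assoc, ← map_mul, ← ofAdd_add]
        · change e (.ofAdd (j - i)) = t * e _ * (t * e _)
          rw [mul_assoc, ← mul_assoc (e _) t, het, mul_assoc, ← mul_assoc t t, ht2, one_mul,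
            ← map_inv, ← map_mul, ← ofAdd_neg, ← ofAdd_add, neg_add_eq_sub] }
  have hφ : Function.Injective φ := by
    rw [injective_iff_map_eq_one]
    rintro (i | i) h
    · have : Multiplicative.ofAdd i = 1 := he (h.trans e.map_one.symm)
      exact congrArg DihedralGroup.r this
    · refine absurd ?_ htH
      rw [eq_inv_of_mul_eq_one_left h]
      exact inv_mem (heH _)
  have hbij : Function.Bijective φ := (Nat.bijective_iff_injective_and_card φ).mpr ⟨hφ, by
    rw [DihedralGroup.nat_card, IsGalois.card_aut_eq_finrank, ← Module.finrank_mul_finrank ℚ K N,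
      hK, hdeg]⟩
  exact ⟨(MulEquiv.ofBijective φ hbij).symm⟩

end Dihedral

/-! ### Norm residues and the conductor -/

section NormResidues

open Pointwise

variable {K N : Type*} [Field K] [NumberField K] [Field N] [NumberField N] [Algebra K N]

/-- The Chinese remainder theorem for the conjugates of a maximal ideal. -/
theorem exists_sub_mem_conjugates (P : Ideal (𝓞 N)) [P.IsMaximal] (z ε : 𝓞 N) :
    ∃ y : 𝓞 N, y - z ∈ P ∧ ∀ g : Gal(N/K), g • P ≠ P → y - ε ∈ g • P := by
  classical
  have hP0 : P ≠ ⊥ := Ideal.IsMaximal.ne_bot_of_isIntegral_int P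
  obtain ⟨y, hy⟩ := IsDedekindDomain.exists_forall_sub_mem_ideal
    (s := Finset.univ.image fun g : Gal(N/K) => g • P) id (fun _ => 1) (fun I hI => by
      obtain ⟨g, _, rfl⟩ := Finset.mem_image.mp hI
      have := ‹P.IsMaximal›.isPrime
      refine Ideal.prime_of_isPrime (P := g • P) (fun h => hP0 ?_) inferInstance
      rw [← inv_smul_smul g P, h]
      exact Ideal.map_bot) (fun _ _ _ _ h => h)
    (fun I => if (I : Ideal (𝓞 N)) = P then z else ε)
  refine ⟨y, ?_, fun g hg => ?_⟩
  · simpa using hy P (Finset.mem_image.mpr ⟨1, Finset.mem_univ _, one_smul _ P⟩)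
  · simpa [hg] using hy (g • P) (Finset.mem_image.mpr ⟨g, Finset.mem_univ _, rfl⟩)

omit [NumberField K] [NumberField N] in
theorem sub_mem_of_smul_ne {P : Ideal (𝓞 N)} {y ε : 𝓞 N}
    (hy : ∀ g : Gal(N/K), g • P ≠ P → y - ε ∈ g • P) (g : Gal(N/K)) (hg : g • P ≠ P) :
    g • y - g • ε ∈ P := by
  have := hy g⁻¹ (fun h => hg (by nth_rw 1 [← h]; exact smul_inv_smul g P))
  rwa [Ideal.mem_inv_pointwise_smul_iff, smul_sub] at this

variable [IsGalois K N]

/-- At an unramified prime, the decomposition group is the Galois group of the residue fields. -/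
theorem bijective_stabilizerHom (P : Ideal (𝓞 N)) [P.IsMaximal]
    (hP : Algebra.IsUnramifiedAt (𝓞 K) P) :
    Function.Bijective (Ideal.Quotient.stabilizerHom P (P.under (𝓞 K)) Gal(N/K)) := by
  refine ⟨?_, Ideal.Quotient.stabilizerHom_surjective _ _ _⟩
  rw [← MonoidHom.ker_eq_bot_iff, Ideal.Quotient.ker_stabilizerHom, eq_bot_iff]
  intro s hs
  have : (s : Gal(N/K)) ∈ P.inertia Gal(N/K) := hs
  rw [inertia_eq_bot K N P hP] at this
  exact Subtype.ext this

omit [NumberField K] [NumberField N] [IsGalois K N] in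
theorem mk_smul_eq_mk_smul {P : Ideal (𝓞 N)} {y z : 𝓞 N} (h : y - z ∈ P)
    (s : MulAction.stabilizer Gal(N/K) P) :
    Ideal.Quotient.mk P ((s : Gal(N/K)) • z) = Ideal.Quotient.mk P ((s : Gal(N/K)) • y) := by
  rw [eq_comm, Ideal.Quotient.eq, ← smul_sub]
  have h1 := Ideal.smul_mem_pointwise_smul (s : Gal(N/K)) _ _ h
  rwa [MulAction.mem_stabilizer_iff.mp s.2] at h1

attribute [local instance] Ideal.Quotient.field in
/-- Modulo an unramified prime, every integer of `K` is a norm. -/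
theorem exists_prod_sub_mem (P : Ideal (𝓞 N)) [P.IsMaximal]
    (hP : Algebra.IsUnramifiedAt (𝓞 K) P) (x : 𝓞 K) :
    ∃ y : 𝓞 N, ∏ g : Gal(N/K), g • y - algebraMap (𝓞 K) (𝓞 N) x ∈ P := by
  have hbij := bijective_stabilizerHom P hP
  have : (P.under (𝓞 K)).IsMaximal := Ideal.IsMaximal.under _ P
  obtain ⟨w, hw⟩ := FiniteField.norm_surjective (𝓞 K ⧸ P.under (𝓞 K)) (𝓞 N ⧸ P)
    (Ideal.Quotient.mk _ x)
  obtain ⟨z, rfl⟩ := Ideal.Quotient.mk_surjective w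
  obtain ⟨y, hyz, hy1⟩ := exists_sub_mem_conjugates (K := K) P z 1
  refine ⟨y, ?_⟩
  have hw' := congrArg (algebraMap (𝓞 K ⧸ P.under (𝓞 K)) (𝓞 N ⧸ P)) hw
  rw [Algebra.norm_eq_prod_automorphisms] at hw'
  rw [← Ideal.Quotient.eq, map_prod]
  refine Eq.trans (Eq.trans ?_ hw') rfl
  have := Fintype.ofFinite (MulAction.stabilizer Gal(N/K) P)
  rw [← Function.Bijective.prod_comp hbij]
  refine (Fintype.prod_of_injective Subtype.val Subtype.val_injective _ _ (fun g hg => ?_)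
    fun s => mk_smul_eq_mk_smul hyz s).symm
  rw [← map_one (Ideal.Quotient.mk P), Ideal.Quotient.eq, ← smul_one g]
  exact sub_mem_of_smul_ne hy1 g fun h => hg ⟨⟨g, h⟩, rfl⟩

attribute [local instance] Ideal.Quotient.field in
/-- Modulo an unramified prime, every integer of `K` is a trace. -/
theorem exists_sum_sub_mem (P : Ideal (𝓞 N)) [P.IsMaximal]
    (hP : Algebra.IsUnramifiedAt (𝓞 K) P) (x : 𝓞 K) :
    ∃ y : 𝓞 N, ∑ g : Gal(N/K), g • y - algebraMap (𝓞 K) (𝓞 N) x ∈ P := by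
  have hbij := bijective_stabilizerHom P hP
  have : (P.under (𝓞 K)).IsMaximal := Ideal.IsMaximal.under _ P
  obtain ⟨w, hw⟩ := Algebra.trace_surjective (𝓞 K ⧸ P.under (𝓞 K)) (𝓞 N ⧸ P)
    (Ideal.Quotient.mk _ x)
  obtain ⟨z, rfl⟩ := Ideal.Quotient.mk_surjective w
  obtain ⟨y, hyz, hy1⟩ := exists_sub_mem_conjugates (K := K) P z 0
  refine ⟨y, ?_⟩
  have hw' := congrArg (algebraMap (𝓞 K ⧸ P.under (𝓞 K)) (𝓞 N ⧸ P)) hw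
  rw [trace_eq_sum_automorphisms] at hw'
  rw [← Ideal.Quotient.eq, map_sum]
  refine Eq.trans (Eq.trans ?_ hw') rfl
  have := Fintype.ofFinite (MulAction.stabilizer Gal(N/K) P)
  rw [← Function.Bijective.sum_comp hbij]
  refine (Fintype.sum_of_injective Subtype.val Subtype.val_injective _ _ (fun g hg => ?_)
    fun s => mk_smul_eq_mk_smul hyz s).symm
  rw [← map_zero (Ideal.Quotient.mk P), Ideal.Quotient.eq, ← smul_zero g]
  exact sub_mem_of_smul_ne hy1 g fun h => hg ⟨⟨g, h⟩, rfl⟩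

/-- The linear approximation of `∏ (1 + π f)`, which exhibits the trace in the norm of `1 + π z`. -/
theorem exists_prod_one_add_mul {R ι : Type*} [CommRing R] (s : Finset ι) (π : R) (f : ι → R) :
    ∃ c, ∏ i ∈ s, (1 + π * f i) = 1 + π * ∑ i ∈ s, f i + π ^ 2 * c := by
  classical
  induction s using Finset.induction_on with
  | empty => exact ⟨0, by simp⟩
  | insert a s ha ih =>
    obtain ⟨c, hc⟩ := ih
    refine ⟨f a * (∑ i ∈ s, f i) + c + π * f a * c, ?_⟩
    rw [Finset.prod_insert ha, Finset.sum_insert ha, hc]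
    ring

theorem algebraMap_norm_eq_prod (y : 𝓞 N) :
    algebraMap (𝓞 K) (𝓞 N) (RingOfIntegers.norm K y) = ∏ g : Gal(N/K), g • y := by
  ext
  rw [RingOfIntegers.coe_algebraMap_norm, Algebra.norm_eq_prod_automorphisms]
  exact (map_prod (algebraMap (𝓞 N) N) (fun g : Gal(N/K) => g • y) Finset.univ).symm

/-- At a prime which is unramified in `N`, every integer of `K` prime to it is a norm residue:
it is a norm modulo the prime, and as the trace is onto modulo the prime, a solution modulo a
power of the prime lifts to the next power. -/
theorem isNormResidue_of_isUnramified
    (hunr : ∀ P : Ideal (𝓞 N), ∀ _ : P.IsPrime, P ≠ ⊥ → Algebra.IsUnramifiedAt (𝓞 K) P)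
    (v : IsDedekindDomain.HeightOneSpectrum (𝓞 K)) (x : 𝓞 K) (hx : x ∉ v.asIdeal) :
    IsNormResidue K N v x := by
  have := v.isMaximal
  obtain ⟨P, hP, hPv⟩ := Ideal.exists_maximal_ideal_liesOver_of_isIntegral (S := 𝓞 N) v.asIdeal
  have hPu := hunr P hP.isPrime (Ideal.IsMaximal.ne_bot_of_isIntegral_int P)
  have hmemv : ∀ a : 𝓞 K, algebraMap (𝓞 K) (𝓞 N) a ∈ P ↔ a ∈ v.asIdeal := fun a => by
    rw [hPv.over]; rfl
  have hmem : ∀ (I : Ideal (𝓞 K)) (a : 𝓞 K),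
      algebraMap (𝓞 K) (𝓞 N) a ∈ I.map (algebraMap (𝓞 K) (𝓞 N)) → a ∈ I := fun I a h => by
    rwa [← Ideal.mem_comap, Ideal.comap_map_eq_self_of_faithfullyFlat] at h
  have main : ∀ m : ℕ, ∃ y : 𝓞 N, RingOfIntegers.norm K y - x ∈ v.asIdeal ^ (m + 1) := by
    intro m
    induction m with
    | zero =>
      obtain ⟨y, hy⟩ := exists_prod_sub_mem P hPu x
      refine ⟨y, ?_⟩
      rwa [zero_add, pow_one, ← hmemv, map_sub, algebraMap_norm_eq_prod]
    | succ m ih =>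
      obtain ⟨y, hy⟩ := ih
      -- with `n = N(y)`, solve `N(1 + π z) ≡ x / n` to first order in `π`
      obtain ⟨n, hn⟩ : ∃ n, n = RingOfIntegers.norm K y := ⟨_, rfl⟩
      have hnv : n ∉ v.asIdeal := fun h => hx <| by
        have := Ideal.pow_le_self (Nat.succ_ne_zero m) hy
        rw [← hn] at this
        simpa using sub_mem h this
      obtain ⟨π, hπ, hπ'⟩ : ∃ π ∈ v.asIdeal ^ (m + 1), π ∉ v.asIdeal ^ (m + 1 + 1) :=
        SetLike.exists_of_lt (Ideal.pow_succ_lt_pow v.ne_bot (m + 1))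
      obtain ⟨d, e, he, hde⟩ := Ideal.exists_mul_add_mem_pow_succ v.ne_bot (n * π) (x - n)
        (Ideal.mul_mem_left _ _ hπ)
        (fun h => (Ideal.IsPrime.mul_mem_pow _ h).elim hnv hπ')
        (by rw [← neg_sub, hn]; exact neg_mem hy)
      obtain ⟨z, hz⟩ := exists_sum_sub_mem P hPu d
      obtain ⟨t, ht⟩ := Algebra.IsInvariant.isInvariant (A := 𝓞 K) (G := Gal(N/K))
        (∑ g : Gal(N/K), g • z) fun h => by
          rw [Finset.smul_sum]
          simp only [smul_smul]
          exact (Group.mulLeft_bijective h).sum_comp fun g => g • z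
      rw [← ht, ← map_sub, hmemv] at hz
      obtain ⟨c, hc⟩ := exists_prod_one_add_mul Finset.univ (algebraMap (𝓞 K) (𝓞 N) π)
        fun g : Gal(N/K) => g • z
      refine ⟨y * (1 + algebraMap _ _ π * z), hmem _ _ ?_⟩
      have hprod : algebraMap (𝓞 K) (𝓞 N)
          (RingOfIntegers.norm K (1 + algebraMap (𝓞 K) (𝓞 N) π * z)) =
          1 + algebraMap (𝓞 K) (𝓞 N) π * algebraMap (𝓞 K) (𝓞 N) t +
            algebraMap (𝓞 K) (𝓞 N) π ^ 2 * c := by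
        rw [algebraMap_norm_eq_prod, ht, ← hc]
        refine Finset.prod_congr rfl fun g _ => ?_
        rw [smul_add, smul_one, smul_mul', smul_algebraMap]
      have hx' : x = n + (n * π * d + e) := by rw [hde]; ring
      have e1 : algebraMap (𝓞 K) (𝓞 N)
          (RingOfIntegers.norm K (y * (1 + algebraMap (𝓞 K) (𝓞 N) π * z)) - x) =
          algebraMap (𝓞 K) (𝓞 N) (n * (π * (t - d)) - e) +
            c * algebraMap (𝓞 K) (𝓞 N) (n * π ^ 2) := by
        rw [map_mul, ← hn, hx']
        simp only [map_sub, map_add, map_mul, map_pow, hprod]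
        ring
      rw [e1]
      refine add_mem (Ideal.mem_map_of_mem _ (sub_mem (Ideal.mul_mem_left _ _ ?_) he))
        (Ideal.mul_mem_left _ _ (Ideal.mem_map_of_mem _ (Ideal.mul_mem_left _ _ ?_)))
      · rw [pow_succ]
        exact Ideal.mul_mem_mul hπ hz
      · rw [pow_two, pow_succ]
        exact Ideal.mul_mem_mul hπ (Ideal.pow_le_self (Nat.succ_ne_zero m) hπ)
  intro m
  obtain ⟨y, hy⟩ := main m
  exact ⟨y, Ideal.pow_le_pow_right (Nat.le_succ m) hy⟩

/-- The conductor of an unramified extension is trivial. -/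
theorem hasConductor_iff
    (hunr : ∀ P : Ideal (𝓞 N), ∀ _ : P.IsPrime, P ≠ ⊥ → Algebra.IsUnramifiedAt (𝓞 K) P)
    (f : ℕ) : HasConductor K N f ↔ f = 1 := by
  have h0 : ∀ v, conductorExponent K N v = 0 := fun v => by
    refine Nat.sInf_eq_zero.mpr (Or.inl ?_)
    exact fun x hx _ => isNormResidue_of_isUnramified hunr v x hx
  rw [HasConductor, conductorIdeal]
  simp only [h0, pow_zero, finprod_one]
  rw [eq_comm, Ideal.one_eq_top, Ideal.span_singleton_eq_top]
  constructor
  · intro h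
    have : IsUnit (f : ℤ) := isUnit_of_map_unit (algebraMap ℤ (𝓞 K)) _ (by simpa using h)
    simpa [Int.isUnit_iff] using this
  · rintro rfl
    simp

end NormResidues

/-! ### Ambiguous principal ideals, units and class groups -/

section AmbiguousIdeals

/-- A root of a unit is a unit. -/
theorem exists_unit_of_pow_eq {F : Type*} [Field F] [NumberField F] {n : ℕ} (hn : n ≠ 0) {x : F}
    {u : (𝓞 F)ˣ} (h : x ^ n = u) : ∃ w : (𝓞 F)ˣ, (w : F) = x := by
  have hu : (u : F) ≠ 0 := NumberField.Units.coe_ne_zero u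
  have hx : x ≠ 0 := by
    rintro rfl
    rw [zero_pow hn] at h
    exact hu h.symm
  have h1 : IsIntegral ℤ x := IsIntegral.of_pow (Nat.pos_of_ne_zero hn)
    (h ▸ NumberField.RingOfIntegers.isIntegral_coe (u : 𝓞 F))
  have h2 : IsIntegral ℤ x⁻¹ := IsIntegral.of_pow (Nat.pos_of_ne_zero hn) (by
    have h3 : (u : F)⁻¹ = ((u⁻¹ : (𝓞 F)ˣ) : F) := (Units.val_inv_eq_inv_val (unitsIn F u)).symm
    rw [inv_pow, h, h3]
    exact NumberField.RingOfIntegers.isIntegral_coe ((u⁻¹ : (𝓞 F)ˣ) : 𝓞 F))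
  exact ⟨⟨⟨x, h1⟩, ⟨x⁻¹, h2⟩, by ext; exact mul_inv_cancel₀ hx,
    by ext; exact inv_mul_cancel₀ hx⟩, rfl⟩

/-- If a power of a principal ideal `(α)` of `N` is extended from `K`, then `(α)` is Galois
invariant. -/
theorem exists_unit_of_toPrincipalIdeal_pow_mem_range {K N : Type*} [Field K] [NumberField K]
    [Field N] [NumberField N] [Algebra K N] [IsGalois K N] {n : ℕ} (hn : n ≠ 0) {α : Nˣ}
    (hα : toPrincipalIdeal (𝓞 N) N α ^ n ∈ (extendIdeals K N).range) (g : Gal(N/K)) :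
    ∃ u : (𝓞 N)ˣ, g α = u * α := by
  rw [← map_pow] at hα
  obtain ⟨u, hu⟩ := exists_unit_of_toPrincipalIdeal_mem_range hα g
  have h : (g α / α) ^ n = (u : N) := by
    rw [div_pow, ← map_pow, ← Units.val_pow_eq_pow_val, hu,
      mul_div_cancel_right₀ _ (Units.ne_zero _)]
  obtain ⟨w, hw⟩ := exists_unit_of_pow_eq hn h
  exact ⟨w, by rw [hw, div_mul_cancel₀ _ α.ne_zero]⟩

/-- In an unramified extension, ambiguous principal ideals are extended from the base field. -/
theorem ambiguousPrincipalIdeals_le_range {K N : Type*} [Field K] [NumberField K]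
    [Field N] [NumberField N] [Algebra K N] [IsGalois K N] {p : ℕ} (hp : p ≠ 0)
    (hunr : ∀ P : Ideal (𝓞 N), ∀ _ : P.IsPrime, P ≠ ⊥ → Algebra.IsUnramifiedAt (𝓞 K) P) :
    ambiguousPrincipalIdeals K N p ≤ (extendIdeals K N).range := by
  rintro _ ⟨hα, α, rfl⟩
  exact toPrincipalIdeal_mem_range hunr fun g =>
    exists_unit_of_toPrincipalIdeal_pow_mem_range hp hα g

theorem extendIdeals_extendIdeals {E F M : Type*} [Field E] [NumberField E] [Field F]
    [NumberField F] [Field M] [NumberField M] [Algebra E F] [Algebra F M] [Algebra E M]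
    [IsScalarTower E F M] (a : Ideals E) :
    extendIdeals F M (extendIdeals E F a) = extendIdeals E M a := by
  obtain ⟨d, I, hI⟩ := exists_toPrincipalIdeal_mul_eq_mk0 a
  rw [← eq_inv_mul_iff_mul_eq] at hI
  rw [hI]
  simp only [map_mul, map_inv, extendIdeals_toPrincipalIdeal, extendIdeals_mk0]
  congr 2
  · congr 1
    ext1
    exact (IsScalarTower.algebraMap_apply E F M d).symm
  · exact Subtype.ext ((Ideal.map_map _ _).trans (congrArg (fun f => Ideal.map f I.1)
      (IsScalarTower.algebraMap_eq (𝓞 E) (𝓞 F) (𝓞 M)).symm))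

theorem principalIdeals_eq_top (F : Type*) [Field F] [NumberField F]
    [IsPrincipalIdealRing (𝓞 F)] : principalIdeals F = ⊤ := by
  rw [← ker_mk, eq_top_iff]
  intro a _
  exact Subsingleton.elim _ _

/-- `N/K` is unramified, so ramification indices of `N/ℚ` are orders of inertia groups of the
quadratic field `K`. -/
theorem ramificationIdx_rat_dvd_two {K N : Type*} [Field K] [NumberField K]
    [Field N] [NumberField N] [Algebra K N] (hK : Module.finrank ℚ K = 2)
    (hunr : ∀ P : Ideal (𝓞 N), ∀ _ : P.IsPrime, P ≠ ⊥ → Algebra.IsUnramifiedAt (𝓞 K) P)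
    (P : Ideal (𝓞 N)) (hP : P.IsPrime) (hP0 : P ≠ ⊥) : P.ramificationIdx (𝓞 ℚ) ∣ 2 := by
  have : Algebra.IsQuadraticExtension ℚ K := ⟨hK⟩
  have hmax := hP.isMaximal hP0
  have := hunr P hP hP0
  have : (P.under (𝓞 K)).IsMaximal := Ideal.IsMaximal.under _ P
  have : ((P.under (𝓞 K)).under (𝓞 ℚ)).IsMaximal := Ideal.IsMaximal.under _ _
  rw [Ideal.ramificationIdx_tower (R := 𝓞 ℚ) (q := P.under (𝓞 K)) (r := P),
    Ideal.ramificationIdx_eq_one P, mul_one]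
  have h1 := Ideal.card_inertia_eq_ramificationIdxIn (G := Gal(K/ℚ))
    ((P.under (𝓞 K)).under (𝓞 ℚ)) (P.under (𝓞 K))
  rw [Ideal.ramificationIdxIn_eq_ramificationIdx ((P.under (𝓞 K)).under (𝓞 ℚ))
    (P.under (𝓞 K)) Gal(K/ℚ)] at h1
  rw [← h1, ← hK, ← IsGalois.card_aut_eq_finrank]
  exact Subgroup.card_subgroup_dvd_card _

/-- In the dihedral field `N`, ramification indices over `ℚ` divide two, which is prime to `p`.
Hence a principal ideal of `L` whose `p`-th power comes from `ℚ` comes from `ℚ` itself. -/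
theorem ambiguousPrincipalIdeals_rat_le {K N : Type*} [Field K] [NumberField K]
    [Field N] [NumberField N] [Algebra K N] [IsGalois ℚ N] (hK : Module.finrank ℚ K = 2)
    {p : ℕ} (hp : p.Prime) (hp2 : p ≠ 2)
    (hunr : ∀ P : Ideal (𝓞 N), ∀ _ : P.IsPrime, P ≠ ⊥ → Algebra.IsUnramifiedAt (𝓞 K) P)
    (L : IntermediateField ℚ N) :
    ambiguousPrincipalIdeals ℚ L p ≤ (principalIdeals ℚ).map (extendIdeals ℚ L) := by
  have : IsPrincipalIdealRing (𝓞 ℚ) :=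
    IsPrincipalIdealRing.of_surjective (Rat.ringOfIntegersEquiv.symm : ℤ →+* 𝓞 ℚ)
      Rat.ringOfIntegersEquiv.symm.surjective
  rw [principalIdeals_eq_top, ← MonoidHom.range_eq_map]
  rintro _ ⟨⟨a, ha⟩, α, rfl⟩
  obtain ⟨β, hβ⟩ : ∃ β : Nˣ, β = Units.map (algebraMap L N).toMonoidHom α := ⟨_, rfl⟩
  have h1 : toPrincipalIdeal (𝓞 N) N β = extendIdeals L N (toPrincipalIdeal (𝓞 L) L α) := by
    rw [extendIdeals_toPrincipalIdeal, hβ]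
  have hp' : toPrincipalIdeal (𝓞 N) N β ^ p ∈ (extendIdeals ℚ N).range := by
    refine ⟨a, ?_⟩
    rw [h1, ← map_pow, ← extendIdeals_extendIdeals (F := L), ha]
    rfl
  have h2 := toPrincipalIdeal_pow_mem_range (ramificationIdx_rat_dvd_two hK hunr) (α := β)
    fun g => exists_unit_of_toPrincipalIdeal_pow_mem_range hp.ne_zero hp' g
  obtain ⟨k, hk⟩ := hp.odd_of_ne_two hp2
  have h3 : toPrincipalIdeal (𝓞 N) N β ∈ (extendIdeals ℚ N).range := by
    rw [hk, pow_succ, pow_mul] at hp'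
    exact (Subgroup.mul_mem_cancel_left _ (pow_mem h2 k)).mp hp'
  obtain ⟨d, hd⟩ := h3
  rw [← extendIdeals_extendIdeals (F := L), h1] at hd
  exact ⟨d, extendIdeals_injective hd⟩

theorem isFpSpaceOfDim_zero {p : ℕ} {G : Type*} [CommGroup G] {A B : Subgroup G} (h : A ≤ B) :
    IsFpSpaceOfDim p (A ⧸ B.subgroupOf A) 0 := by
  have : Subsingleton (A ⧸ B.subgroupOf A) := by
    rw [Subgroup.subgroupOf_eq_top.mpr h]
    exact QuotientGroup.subsingleton_quotient_top
  exact ⟨fun v => Subsingleton.elim _ _, by rw [pow_zero]; exact Nat.card_unique⟩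

end AmbiguousIdeals

section Units

variable {p : ℕ} {K N : Type*} [Field K] [NumberField K] [Field N] [NumberField N] [Algebra K N]
  [IsGalois K N]

theorem pow_mem_range_norm (hdeg : Module.finrank K N = p) :
    (powMonoidHom p : (𝓞 K)ˣ →* (𝓞 K)ˣ).range ≤
      (Units.map (RingOfIntegers.norm K : 𝓞 N →* 𝓞 K)).range := by
  rintro _ ⟨u, rfl⟩
  refine ⟨Units.map (algebraMap (𝓞 K) (𝓞 N)).toMonoidHom u, ?_⟩
  ext
  refine (Algebra.norm_algebraMap (S := N) (u : K)).trans ?_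
  rw [hdeg]
  rfl

theorem unitNormIndex_pow (hdeg : Module.finrank K N = p) (v : UnitNormIndex K N) : v ^ p = 1 := by
  obtain ⟨u, rfl⟩ := QuotientGroup.mk_surjective v
  rw [← QuotientGroup.mk_pow, QuotientGroup.eq_one_iff]
  exact pow_mem_range_norm hdeg ⟨u, rfl⟩

/-- The order of `U_K / N(U_N)` divides that of `U_K / U_K ^ p`, which Dirichlet's unit theorem
provides. -/
theorem card_unitNormIndex_dvd (hp : p ≠ 0) (hdeg : Module.finrank K N = p) :
    Nat.card (UnitNormIndex K N) ∣ p ^ NumberField.Units.rank K *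
      Nat.card (powMonoidHom p : (𝓞 K)ˣ →* (𝓞 K)ˣ).ker := by
  have h := index_range_nsmul_eq (Additive (𝓞 K)ˣ) hp
  rw [NumberField.Units.finrank_eq] at h
  have h1 : (nsmulAddMonoidHom p : Additive (𝓞 K)ˣ →+ Additive (𝓞 K)ˣ).range =
    (powMonoidHom p : (𝓞 K)ˣ →* (𝓞 K)ˣ).range.toAddSubgroup := rfl
  have h2 : Nat.card (nsmulAddMonoidHom p : Additive (𝓞 K)ˣ →+ Additive (𝓞 K)ˣ).ker =
    Nat.card (powMonoidHom p : (𝓞 K)ˣ →* (𝓞 K)ˣ).ker := rfl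
  rw [← h2, ← h, h1, Subgroup.index_toAddSubgroup]
  exact Subgroup.index_dvd_of_le (pow_mem_range_norm hdeg)

omit [IsGalois K N] in
/-- If `I` becomes principal, generated by `x`, then `I ^ p = N(I 𝓞_N)` is generated by the norm
of `x`. -/
theorem capitulationKernel_pow (hdeg : Module.finrank K N = p) (c : CapitulationKernel K N) :
    c ^ p = 1 := by
  obtain ⟨c, hc⟩ := c
  refine Subtype.ext ?_
  change c ^ p = 1
  obtain ⟨I, rfl⟩ := ClassGroup.mk0_surjective c
  rw [MonoidHom.mem_ker, ClassGroup.extendedHom_mk0, ClassGroup.mk0_eq_one_iff] at hc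
  obtain ⟨x, hx⟩ := hc
  rw [← map_pow, ClassGroup.mk0_eq_one_iff]
  have h1 : Ideal.relNorm (𝓞 K) (I.1.map (algebraMap (𝓞 K) (𝓞 N))) = I.1 ^ p := by
    rw [Ideal.relNorm_algebraMap, ← IsFractionRing.finrank_eq (𝓞 K) K (𝓞 N) N, hdeg]
  refine ⟨_, h1.symm.trans ((congrArg _ hx).trans (Ideal.relNorm_singleton _ x))⟩

omit [IsGalois K N] in
/-- The capitulation kernel lies in the `p`-torsion of `Cl(K)`, whose order is that of
`Cl(K) / Cl(K) ^ p`. -/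
theorem card_capitulationKernel_dvd (hdeg : Module.finrank K N = p) {ϱ : ℕ}
    (hϱ : HasPClassRank p K ϱ) : Nat.card (CapitulationKernel K N) ∣ p ^ ϱ := by
  have h : (ClassGroup.extendedHom (𝓞 K) (𝓞 N)).ker ≤
      (powMonoidHom p : ClassGroup (𝓞 K) →* _).ker := fun c hc =>
    congrArg Subtype.val (capitulationKernel_pow hdeg ⟨c, hc⟩)
  rw [← hϱ.2]
  change _ ∣ Subgroup.index _
  rw [Subgroup.index_range]
  exact Subgroup.card_dvd_of_le h

theorem card_ker_pow_of_isTotallyReal [NumberField.IsTotallyReal K] (hp : Odd p) :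
    Nat.card (powMonoidHom p : (𝓞 K)ˣ →* (𝓞 K)ˣ).ker = 1 := by
  rw [Subgroup.card_eq_one, eq_bot_iff]
  intro u hu
  obtain ⟨w⟩ : Nonempty (NumberField.InfinitePlace K) := inferInstance
  let φ := NumberField.InfinitePlace.embedding_of_isReal (NumberField.IsTotallyReal.isReal w)
  have h1 : φ (u : K) ^ p = 1 ^ p := by
    have h2 : (u : K) ^ p = 1 := congrArg (fun v : (𝓞 K)ˣ => (v : K)) (MonoidHom.mem_ker.mp hu)
    rw [← map_pow, h2, map_one, one_pow]
  have h3 := hp.strictMono_pow.injective h1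
  rw [← map_one φ] at h3
  exact Units.ext (NumberField.RingOfIntegers.ext (φ.injective h3))

/-- A quadratic field with a nontrivial `p`-th root of unity, `p` odd, is `ℚ(ζ₃)`, which has class
number one. -/
theorem subsingleton_classGroup_of_pow_eq_one (hK : Module.finrank ℚ K = 2) (hp : p.Prime)
    (hp2 : p ≠ 2) {u : (𝓞 K)ˣ} (hu : u ≠ 1) (hup : u ^ p = 1) :
    Subsingleton (ClassGroup (𝓞 K)) := by
  have hζ : IsPrimitiveRoot (u : K) p := by
    have := Fact.mk hp
    rw [← orderOf_eq_prime (x := (u : K)) (congrArg (fun v : (𝓞 K)ˣ => (v : K)) hup)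
      fun h => hu (Units.ext (NumberField.RingOfIntegers.ext h))]
    exact IsPrimitiveRoot.orderOf _
  have : NeZero p := ⟨hp.ne_zero⟩
  obtain ⟨E, hE⟩ : ∃ E, E = IntermediateField.adjoin ℚ {(u : K)} := ⟨_, rfl⟩
  have hcyc : IsCyclotomicExtension {p} ℚ E :=
    hE ▸ hζ.intermediateField_adjoin_isCyclotomicExtension ℚ
  have hfin : Module.finrank ℚ E = p - 1 := by
    rw [IsCyclotomicExtension.finrank (n := p) E
      (Polynomial.cyclotomic.irreducible_rat hp.pos), Nat.totient_prime hp]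
  have hdvd : p - 1 ∣ 2 := by
    rw [← hfin, ← hK, ← Module.finrank_mul_finrank ℚ E K]
    exact dvd_mul_right _ _
  have hp3 : p = 3 := by
    have := Nat.le_of_dvd two_pos hdvd
    have := hp.two_le
    omega
  subst hp3
  have htop : E = ⊤ := IntermediateField.eq_of_le_of_finrank_eq le_top (by
    rw [hfin, IntermediateField.finrank_top', hK])
  have : IsCyclotomicExtension {3} ℚ K := IsCyclotomicExtension.equiv {3} ℚ E
    ((IntermediateField.equivOfEq htop).trans IntermediateField.topEquiv)
  have := IsCyclotomicExtension.Rat.three_pid K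
  infer_instance

end Units

/-! ### The types -/

section Types

variable {p : ℕ} {K N : Type*} [Field K] [NumberField K] [Field N] [NumberField N] [Algebra K N]
  [IsGalois K N]

/-- A real quadratic field has unit rank one and no roots of unity of order `p`. -/
theorem card_unitNormIndex_of_isTotallyReal [NumberField.IsTotallyReal N] (hp : p.Prime)
    (hp2 : p ≠ 2) (hK : Module.finrank ℚ K = 2) (hdeg : Module.finrank K N = p) :
    Nat.card (UnitNormIndex K N) = 1 ∨ Nat.card (UnitNormIndex K N) = p := by
  have : NumberField.IsTotallyReal K := NumberField.IsTotallyReal.of_algebra K N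
  have h := card_unitNormIndex_dvd (K := K) (N := N) hp.ne_zero hdeg
  rw [card_ker_pow_of_isTotallyReal (hp.odd_of_ne_two hp2), mul_one, NumberField.Units.rank,
    NumberField.InfinitePlace.card_eq_nrRealPlaces_add_nrComplexPlaces,
    NumberField.IsTotallyReal.nrComplexPlaces_eq_zero, ← NumberField.IsTotallyReal.finrank, hK,
    add_zero, pow_one] at h
  exact (Nat.dvd_prime hp).mp h

/-- An imaginary quadratic field has unit rank zero. If it contained roots of unity of order `p`,
its class number would be one, leaving no room for the capitulation kernel. -/
theorem card_unitNormIndex_of_isTotallyComplex [NumberField.IsTotallyComplex N] (hp : p.Prime)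
    (hp2 : p ≠ 2) (hK : Module.finrank ℚ K = 2) (hdeg : Module.finrank K N = p)
    (hcap : Nat.card (CapitulationKernel K N) = p * Nat.card (UnitNormIndex K N)) :
    Nat.card (UnitNormIndex K N) = 1 := by
  have h := card_unitNormIndex_dvd (K := K) (N := N) hp.ne_zero hdeg
  have hodd : Odd (Module.finrank K N) := hdeg ▸ hp.odd_of_ne_two hp2
  have := IsUnramifiedAtInfinitePlaces_of_odd_finrank hodd
  have h1 := IsUnramifiedAtInfinitePlaces.card_infinitePlace K N
  have h2 := NumberField.IsTotallyComplex.finrank (K := N)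
  have h3 := NumberField.InfinitePlace.card_eq_nrRealPlaces_add_nrComplexPlaces N
  rw [NumberField.IsTotallyComplex.nrRealPlaces_eq_zero, zero_add] at h3
  rw [← Module.finrank_mul_finrank ℚ K N, hK, hdeg, ← h3, h1, hdeg] at h2
  have hrank : NumberField.Units.rank K = 0 := by
    have := hp.pos
    have h4 : Fintype.card (NumberField.InfinitePlace K) = 1 := by nlinarith
    rw [NumberField.Units.rank, h4]
  have hker : Nat.card (powMonoidHom p : (𝓞 K)ˣ →* (𝓞 K)ˣ).ker = 1 := by
    rw [Subgroup.card_eq_one, eq_bot_iff]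
    intro u hu
    by_contra hu1
    have := subsingleton_classGroup_of_pow_eq_one hK hp hp2 hu1 hu
    rw [Nat.card_unique] at hcap
    exact hp.one_lt.ne' (Nat.dvd_one.mp (Dvd.intro _ hcap.symm))
  rw [hrank, hker, pow_zero, one_mul] at h
  exact Nat.dvd_one.mp h

/-- For an unramified cyclic extension the numbers `A` and `R` vanish, and `C = U + 1`. -/
theorem hasDPFInvariants (hp : p.Prime) (hp2 : p ≠ 2) (hK : Module.finrank ℚ K = 2)
    (hdeg : Module.finrank K N = p)
    (hunr : ∀ P : Ideal (𝓞 N), ∀ _ : P.IsPrime, P ≠ ⊥ → Algebra.IsUnramifiedAt (𝓞 K) P)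
    (hcap : Nat.card (CapitulationKernel K N) = p * Nat.card (UnitNormIndex K N)) {U : ℕ}
    (hU : Nat.card (UnitNormIndex K N) = p ^ U) : HasDPFInvariants p K N U 0 0 (U + 1) := by
  have hcyc : IsCyclic Gal(N/K) := by
    have := Fact.mk hp
    exact isCyclic_of_prime_card (p := p) (by rw [IsGalois.card_aut_eq_finrank, hdeg])
  have hgal := isGalois_rat_of_isUnramified K N hK
    (fun a b => hcyc.commGroup.mul_comm a b) hunr
  exact {
    isGalois := hgal
    dihedral := nonempty_mulEquiv_dihedralGroup K N hK hp hdeg hunr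
    unitNormIndex := ⟨unitNormIndex_pow hdeg, hU⟩
    absolute := fun L _ => isFpSpaceOfDim_zero (ambiguousPrincipalIdeals_rat_le hK hp hp2 hunr L)
    relative := fun L _ => isFpSpaceOfDim_zero
      (inf_le_left.trans (ambiguousPrincipalIdeals_le_range hp.ne_zero hunr))
    capitulation := ⟨capitulationKernel_pow hdeg, by rw [hcap, hU, pow_succ']⟩ }

end Types

end DPF

theorem mainTheorem3 (p : ℕ) (hp : p.Prime) (hp2 : p ≠ 2)
    (K N : Type*) [Field K] [NumberField K] [Field N] [NumberField N] [Algebra K N]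
    (hK : Module.finrank ℚ K = 2) (hgal : IsGalois K N) (hcyc : IsCyclic Gal(N/K))
    (hdeg : Module.finrank K N = p)
    (hunr : ∀ P : Ideal (𝓞 N), ∀ _ : P.IsPrime, P ≠ ⊥ → Algebra.IsUnramifiedAt (𝓞 K) P)
    (ϱ : ℕ) (hϱ : DPF.HasPClassRank p K ϱ) :
    (∀ f : ℕ, DPF.HasConductor K N f ↔ f = 1) ∧
    (NumberField.IsTotallyReal N →
      (ϱ = 1 → DPF.IsOfRealType p K N .δ₁) ∧
      (2 ≤ ϱ → DPF.IsOfRealType p K N .α₁ ∨ DPF.IsOfRealType p K N .δ₁)) ∧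
    (NumberField.IsTotallyComplex N → DPF.IsOfComplexType p K N .α₁) := by
  obtain ⟨g, hg⟩ := hcyc.exists_generator
  have hcap := DPF.card_capitulationKernel K N hg hp hp2 hdeg hunr
  have hinv := fun U => DPF.hasDPFInvariants (U := U) hp hp2 hK hdeg hunr hcap
  refine ⟨DPF.hasConductor_iff hunr, fun hreal => ⟨fun h1 => ?_, fun _ => ?_⟩, fun hcomplex => ?_⟩
  · refine hinv 0 ?_
    have h := DPF.card_capitulationKernel_dvd hdeg hϱ
    rw [hcap, h1, pow_one] at h
    exact Nat.dvd_one.mp (Nat.dvd_of_mul_dvd_mul_left hp.pos (by rwa [mul_one]))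
  · rcases DPF.card_unitNormIndex_of_isTotallyReal hp hp2 hK hdeg with h | h
    · exact Or.inr (hinv 0 h)
    · exact Or.inl (hinv 1 (by rw [h, pow_one]))
  · exact hinv 0 (DPF.card_unitNormIndex_of_isTotallyComplex hp hp2 hK hdeg hcap)
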